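/- **Notation.** For $a\in\mathbb C$, $n\in\mathbb N_0$ let $(a)_n=a(a+1)\cdots(a+n-1)$. For $\varkappa,\varrho,\Upsilon,\gamma_1,\dots,\gamma_4\in\mathbb C$ with $\operatorname{Re}\varkappa,\operatorname{Re}\varrho,\operatorname{Re}\Upsilon>0$ put $$E_{\varkappa,\varrho,\Upsilon}^{(\gamma_1;\gamma_2;\gamma_3;\gamma_4)}(X,Y)=\sum_{s=0}^\infty\sum_{r=0}^\infty\frac{(\gamma_1)_{2s}(\gamma_2)_{s+r}}{(\gamma_3)_s(\gamma_4)_s}\,\frac{X^sY^{\Upsilon r}}{\Gamma(\varkappa+s)\Gamma(\varrho+\Upsilon r)\,r!\,s!}$$ (principal branch of the powers; $Y^{0}=1$). Only $\gamma_3=\frac{\gamma_1+1}2$, $\gamma_4=\gamma_2$ is used below; then the first quotient equals $4^s(\frac{\gamma_1}{2})_s(\gamma_2+s)_r$, and this value is used also where $(\gamma_3)_s(\gamma_4)_s=0$. For reals $A<B$, $C<D$ and $\nu_1,\nu_2\in\mathbb C$ let, for $X>A$, $Y>C$, $$\big(\mathbb I_{\varkappa,\varrho,\Upsilon,\nu_1,\nu_2}^{(\gamma_1;\gamma_2;\gamma_3;\gamma_4)}\psi\big)(X,Y)=\int_C^Y\!\!\int_A^X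 (X-t)^{\varkappa-1}(Y-\Omega)^{\varrho-1}E_{\varkappa,\varrho,\Upsilon}^{(\gamma_1;\gamma_2;\gamma_3;\gamma_4)}(\nu_1(X-t),\nu_2(Y-\Omega))\,\psi(t,\Omega)\,dt\,d\Omega .$$ For $\operatorname{Re}\alpha,\operatorname{Re}\beta>0$, $n=\lfloor\operatorname{Re}\alpha\rfloor+1$, $m=\lfloor\operatorname{Re}\beta\rfloor+1$, let $${}_YD_{C^+}^{\beta}\,{}_XD_{A^+}^{\alpha}\,g(X,Y)=\frac{\partial^m}{\partial Y^m}\frac{\partial^n}{\partial X^n}\left[\frac1{\Gamma(m-\beta)\Gamma(n-\alpha)}\int_C^Y\!\!\int_A^X (X-t)^{n-\alpha-1}(Y-\Omega)^{m-\beta-1}g(t,\Omega)\,dt\,d\Omega\right].$$ **Theorem.** Let $A<B$ and $C<D$ be real and let $\varkappa,\varrho,\sigma,\eta,\Upsilon,\nu_1,\nu_2,\gamma_1,\gamma_2\in\mathbb C$ with $\operatorname{Re}\varkappa,\operatorname{Re}\varrho,\operatorname{Re}\sigma,\operatorname{Re}\eta,\operatorname{Re}\Upsilon>0$. Then the operator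 $\mathbb I=\mathbb I_{\varkappa,\varrho,\Upsilon,\nu_1,\nu_2}^{(\gamma_1;\gamma_2;\frac{\gamma_1+1}2;\gamma_2)}$ maps $L_1((A,B)\times(C,D))$ (complex-valued functions) into itself and has on this space the left inverse $$\mathbb D={}_YD_{C^+}^{\varrho+\eta}\,{}_XD_{A^+}^{\varkappa+\sigma}\circ\mathbb I_{\sigma,\eta,\Upsilon,\nu_1,\nu_2}^{(-\gamma_1;-\gamma_2;\frac{-\gamma_1+1}2;-\gamma_2)} .$$ That is, for every $\psi\in L_1((A,B)\times(C,D))$ and every function $f$ that equals $\mathbb I\psi$ almost everywhere on $(A,B)\times(C,D)$, at almost every $(X,Y)\in(A,B)\times(C,D)$ the partial derivatives in the definition of $\mathbb Df$ exist in the classical sense (for the $X$-derivatives: at $(X,y)$ for all $y$ near $Y$) and $(\mathbb Df)(X,Y)=\psi(X,Y)$. -/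

import Mathlib

open Set Filter Topology MeasureTheory

/-- The Pochhammer symbol `(a)_n = a (a + 1) ⋯ (a + n - 1)`. -/
noncomputable def poch (a : ℂ) (n : ℕ) : ℂ := (ascPochhammer ℂ n).eval a

/-- The parameter part `(γ₁)_{2s} (γ₂)_{s+r} / ((γ₃)_s (γ₄)_s)` of the coefficients of the modified
bivariate Hermite-Konhauser Mittag-Leffler function.

For `γ₃ = (γ₁ + 1) / 2`, `γ₄ = γ₂` the duplication formula
`(γ₁)_{2s} = 4 ^ s (γ₁ / 2)_s ((γ₁ + 1) / 2)_s` and `(γ₂)_{s+r} = (γ₂)_s (γ₂ + s)_r` turn the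
quotient into the polynomial `4 ^ s (γ₁ / 2)_s (γ₂ + s)_r`.  In this family, when the
denominator vanishes, the quotient (which then reads `0 / 0`) is given the value of that polynomial,
i.e. its limit within the family. -/
noncomputable def hkCoeff (γ₁ γ₂ γ₃ γ₄ : ℂ) (s r : ℕ) : ℂ :=
  if poch γ₃ s * poch γ₄ s = 0 ∧ γ₃ = (γ₁ + 1) / 2 ∧ γ₄ = γ₂ then
    4 ^ s * poch (γ₁ / 2) s * poch (γ₂ + s) r
  else
    poch γ₁ (2 * s) * poch γ₂ (s + r) / (poch γ₃ s * poch γ₄ s)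

theorem poch_two_mul (a : ℂ) (s : ℕ) :
    poch a (2 * s) = 4 ^ s * poch (a / 2) s * poch ((a + 1) / 2) s := by
  induction s with
  | zero => simp [poch]
  | succ k ih =>
    have h : 2 * (k + 1) = 2 * k + 1 + 1 := by ring
    rw [h]
    simp only [poch, ascPochhammer_succ_eval] at ih ⊢
    rw [ih]
    push_cast
    ring

theorem poch_add (a : ℂ) (s r : ℕ) : poch a (s + r) = poch a s * poch (a + s) r := by
  induction r with
  | zero => simp [poch]
  | succ k ih =>
    rw [← add_assoc]
    simp only [poch, ascPochhammer_succ_eval] at ih ⊢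
    rw [ih]
    push_cast
    ring

/-- Whenever the denominator does not vanish, `hkCoeff` is the literal quotient. -/
theorem hkCoeff_eq_div (γ₁ γ₂ γ₃ γ₄ : ℂ) (s r : ℕ) (h : poch γ₃ s * poch γ₄ s ≠ 0) :
    hkCoeff γ₁ γ₂ γ₃ γ₄ s r =
      poch γ₁ (2 * s) * poch γ₂ (s + r) / (poch γ₃ s * poch γ₄ s) := by
  simp [hkCoeff, h]

/-- In the family `γ₃ = (γ₁ + 1) / 2`, `γ₄ = γ₂`, the coefficient is a polynomial in `γ₁, γ₂`. -/
theorem hkCoeff_family (γ₁ γ₂ : ℂ) (s r : ℕ) :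
    hkCoeff γ₁ γ₂ ((γ₁ + 1) / 2) γ₂ s r = 4 ^ s * poch (γ₁ / 2) s * poch (γ₂ + s) r := by
  by_cases h : poch ((γ₁ + 1) / 2) s * poch γ₂ s = 0
  · simp [hkCoeff, h]
  · rw [hkCoeff_eq_div _ _ _ _ _ _ h, div_eq_iff h, poch_two_mul, poch_add]
    ring

/-- The modified bivariate Hermite-Konhauser Mittag-Leffler function
`E_{κ,ρ,Υ}^{(γ₁;γ₂;γ₃;γ₄)}(X, Y)`; powers `Y ^ (Υ r)` use the principal branch. -/
noncomputable def hkMittagLeffler (κ ρ Υ γ₁ γ₂ γ₃ γ₄ : ℂ) (X Y : ℂ) : ℂ :=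
  ∑' s : ℕ, ∑' r : ℕ, hkCoeff γ₁ γ₂ γ₃ γ₄ s r * X ^ s * Y ^ (Υ * (r : ℂ)) /
    (Complex.Gamma (κ + s) * Complex.Gamma (ρ + Υ * r) * (r.factorial : ℂ) * (s.factorial : ℂ))

/-- The integral operator `𝕀_{κ,ρ,Υ,ν₁,ν₂}^{(γ₁;γ₂;γ₃;γ₄)}` with lower limits `A⁺, C⁺`. -/
noncomputable def hkIntegral (A C : ℝ) (κ ρ Υ ν₁ ν₂ γ₁ γ₂ γ₃ γ₄ : ℂ) (ψ : ℝ × ℝ → ℂ) :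
    ℝ × ℝ → ℂ := fun p =>
  ∫ w in C..p.2, ∫ t in A..p.1,
    ((p.1 - t : ℝ) : ℂ) ^ (κ - 1) * ((p.2 - w : ℝ) : ℂ) ^ (ρ - 1) *
      hkMittagLeffler κ ρ Υ γ₁ γ₂ γ₃ γ₄ (ν₁ * ((p.1 - t : ℝ) : ℂ)) (ν₂ * ((p.2 - w : ℝ) : ℂ)) *
      ψ (t, w)

/-- The double Riemann-Liouville fractional integral, of order `μ` in the first variable (from `A`)
and of order `ζ` in the second variable (from `C`). -/
noncomputable def rlIntegral₂ (A C : ℝ) (μ ζ : ℂ) (g : ℝ × ℝ → ℂ) : ℝ × ℝ → ℂ := fun p =>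
  1 / (Complex.Gamma ζ * Complex.Gamma μ) *
    ∫ w in C..p.2, ∫ t in A..p.1,
      ((p.1 - t : ℝ) : ℂ) ^ (μ - 1) * ((p.2 - w : ℝ) : ℂ) ^ (ζ - 1) * g (t, w)

/-- The integer `⌊Re α⌋ + 1` attached to a fractional order `α` with `Re α ≥ 0`. -/
noncomputable def rlOrder (α : ℂ) : ℕ := ⌊α.re⌋₊ + 1

/-- The partial Riemann-Liouville fractional derivative `D_Y^β D_X^α`, that is
`∂_Y^m ∂_X^n I_Y^{m-β} I_X^{n-α} g` with `n = ⌊Re α⌋ + 1`, `m = ⌊Re β⌋ + 1`. -/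
noncomputable def rlDeriv₂ (A C : ℝ) (α β : ℂ) (g : ℝ × ℝ → ℂ) : ℝ × ℝ → ℂ := fun p =>
  iteratedDeriv (rlOrder β) (fun y : ℝ =>
    iteratedDeriv (rlOrder α) (fun x : ℝ =>
      rlIntegral₂ A C (rlOrder α - α) (rlOrder β - β) g (x, y)) p.1) p.2

/-- `f` has a classical `n`-th derivative at `x`: it is of class `C^(n-1)` near `x` and
its `(n-1)`-st derivative is differentiable at `x`. -/
def IterDifferentiableAt : ℕ → (ℝ → ℂ) → ℝ → Prop
  | 0, _, _ => True
  | k + 1, f, x => ContDiffAt ℝ (k : ℕ) f x ∧ DifferentiableAt ℝ (iteratedDeriv k f) x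

/-- All the derivatives that occur in `rlDeriv₂ A C α β g p` exist in the classical sense. -/
def RLDeriv₂ExistsAt (A C : ℝ) (α β : ℂ) (g : ℝ × ℝ → ℂ) (p : ℝ × ℝ) : Prop :=
  (∀ᶠ y in 𝓝 p.2, IterDifferentiableAt (rlOrder α)
    (fun x : ℝ => rlIntegral₂ A C (rlOrder α - α) (rlOrder β - β) g (x, y)) p.1) ∧
  IterDifferentiableAt (rlOrder β) (fun y : ℝ =>
    iteratedDeriv (rlOrder α) (fun x : ℝ =>
      rlIntegral₂ A C (rlOrder α - α) (rlOrder β - β) g (x, y)) p.1) p.2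

/-- The fractional derivative operator
`𝔻 = D_Y^{ρ+η} D_X^{κ+σ} ∘ 𝕀_{σ,η,Υ,ν₁,ν₂}^{(-γ₁;-γ₂;(-γ₁+1)/2;-γ₂)}`. -/
noncomputable def hkDeriv (A C : ℝ) (κ ρ σ η Υ ν₁ ν₂ γ₁ γ₂ : ℂ) (f : ℝ × ℝ → ℂ) : ℝ × ℝ → ℂ :=
  rlDeriv₂ A C (κ + σ) (ρ + η)
    (hkIntegral A C σ η Υ ν₁ ν₂ (-γ₁) (-γ₂) ((-γ₁ + 1) / 2) (-γ₂) f)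

/-!
The operator `𝕀` is the convolution, on the rectangle `(A, B) × (C, D)`, with the kernel
`x ^ (κ - 1) y ^ (ρ - 1) E(ν₁ x, ν₂ y)`, which expands as
`∑ c_{s,r} x ^ (κ + s - 1) / Γ(κ + s) * (y ^ (ρ + Υ r - 1) / Γ(ρ + Υ r))`. The generating function
of the coefficients is `(1 - b v) ^ (-γ₂) * (1 - a u / (1 - b v)) ^ (-γ₁ / 2)` with `a = 4 ν₁`,
`b = ν₂ ^ Υ`, so changing the signs of `γ₁, γ₂` inverts the array `c` with respect to Cauchy
products (`sum_kerCoeff_mul_kerCoeff_neg`, a consequence of the Chu-Vandermonde identity). As the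
convolution of power kernels adds the exponents (the beta integral), the kernels of the two
operators convolve to the single power kernel of order `(κ + σ, ρ + η)`
(`integral_hkKernel_mul_hkKernel_neg`). Absolute convergence rests on `summable_pow_div_Gamma`: up
to the factor `1 / Γ(Υ)`, the ratios of consecutive values of `1 / Γ(ρ + Υ r)` are beta integrals
tending to `0`.

Hence the composition of the two operators is almost everywhere the mixed Riemann-Liouville
integral of `ψ` of order `(κ + σ, ρ + η)`. A further Riemann-Liouville integration raises the
orders to the integers `n, m ≥ 1`. Here the convolution of the absolute values of the kernels is
bounded, so the identity holds at every point of the rectangle and not just almost everywhere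
(`boxConv_boxConv_of_bounded`, `rlIntegral₂_eq_cauchyInt`); this matters because the result is to
be differentiated classically.

What remains is that the repeated integral of orders `n, m` of an integrable function is undone by
`n` derivatives in `X` and then `m` derivatives in `Y` (`ae_iterDifferentiableAt_cauchyInt₂`). All
but the last derivative in each variable are elementary. The last one is the Lebesgue
differentiation theorem, for which the exceptional null set of `X` must not depend on `y`: this
follows from the case of rational `y`, because the increments in `y` are dominated by those of a
monotone continuous family (`ae_forall_hasDerivAt_integral`).
-/

/-! ### The coefficients and their Cauchy inverse -/

/-- The rising binomial coefficient `(a)_n / n!`, the coefficient of `v ^ n` in `(1 - v) ^ (-a)`. -/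
noncomputable def risingBinom (a : ℂ) (n : ℕ) : ℂ := poch a n / (n.factorial : ℂ)

theorem risingBinom_eq_choose (a : ℂ) (n : ℕ) :
    risingBinom a n = (-1) ^ n * Ring.choose (-a) n := by
  have h1 := Ring.factorial_nsmul_multichoose_eq_ascPochhammer a n
  have h2 := Ring.choose_neg' a n
  rw [Polynomial.ascPochhammer_smeval_eq_eval, nsmul_eq_mul] at h1
  have h3 : ((n.factorial : ℕ) : ℂ) ≠ 0 := by exact_mod_cast n.factorial_ne_zero
  rw [risingBinom, poch, ← h1, mul_div_cancel_left₀ _ h3, h2, Int.negOnePow_def, Units.smul_def,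
    zsmul_eq_mul]
  rw [← mul_assoc, zpow_natCast]
  push_cast
  rw [← mul_pow]
  simp

/-- The Chu-Vandermonde identity for rising factorials. -/
theorem risingBinom_add (a b : ℂ) (n : ℕ) :
    risingBinom (a + b) n =
      ∑ p ∈ Finset.HasAntidiagonal.antidiagonal n, risingBinom a p.1 * risingBinom b p.2 := by
  rw [risingBinom_eq_choose, neg_add, Ring.add_choose_eq n (Commute.all _ _), Finset.mul_sum]
  refine Finset.sum_congr rfl fun p hp => ?_
  rw [risingBinom_eq_choose, risingBinom_eq_choose,
    ← Finset.HasAntidiagonal.mem_antidiagonal.1 hp, pow_add]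
  ring

theorem risingBinom_zero_right (a : ℂ) : risingBinom a 0 = 1 := by simp [risingBinom, poch]

theorem risingBinom_zero_left (n : ℕ) : risingBinom 0 n = if n = 0 then 1 else 0 := by
  cases n with
  | zero => simp [risingBinom, poch]
  | succ n => simp [risingBinom, poch, ascPochhammer_succ_left]

theorem risingBinom_succ (a : ℂ) (n : ℕ) :
    risingBinom a (n + 1) = risingBinom a n * ((a + n) / (n + 1)) := by
  have h3 : ((n.factorial : ℕ) : ℂ) ≠ 0 := by exact_mod_cast n.factorial_ne_zero
  have h4 : (n + 1 : ℂ) ≠ 0 := by exact_mod_cast n.succ_ne_zero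
  rw [risingBinom, risingBinom, poch, poch, ascPochhammer_succ_eval, Nat.factorial_succ]
  push_cast
  field_simp

theorem norm_risingBinom_le (a : ℂ) (N n : ℕ) (h : ‖a‖ ≤ N) :
    ‖risingBinom a n‖ ≤ 2 ^ (N + n) := by
  have key : ‖risingBinom a n‖ ≤ ((N + n).choose n : ℝ) := by
    induction n with
    | zero => simp [risingBinom_zero_right]
    | succ n ih =>
      have h5 : ((n + 1 : ℕ) : ℝ) * ((N + (n + 1)).choose (n + 1) : ℝ)
          = ((N + n + 1 : ℕ) : ℝ) * ((N + n).choose n : ℝ) := by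
        have := Nat.add_one_mul_choose_eq (N + n) n
        rw [← Nat.cast_mul, ← Nat.cast_mul, this, mul_comm]; rfl
      have h6 : (0 : ℝ) < n + 1 := by positivity
      have h7 : ‖(a + n) / (n + 1 : ℂ)‖ ≤ (N + n + 1) / (n + 1) := by
        rw [norm_div]
        have : ‖(n + 1 : ℂ)‖ = n + 1 := by
          rw [← Nat.cast_succ, Complex.norm_natCast]; push_cast; rfl
        rw [this]
        gcongr
        calc ‖a + n‖ ≤ ‖a‖ + ‖(n : ℂ)‖ := norm_add_le _ _
          _ ≤ N + n + 1 := by rw [Complex.norm_natCast]; linarith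
      rw [risingBinom_succ, norm_mul]
      calc _ ≤ ((N + n).choose n : ℝ) * ((N + n + 1) / (n + 1)) := by gcongr
        _ = _ := by
          push_cast at h5
          field_simp
          linarith
  refine key.trans ?_
  exact_mod_cast Nat.choose_le_two_pow _ _

/-- The coefficient of `x ^ (κ + s - 1) / Γ(κ + s) * (y ^ (ρ + Υ r - 1) / Γ(ρ + Υ r))`, for
`p = (s, r)`, in the kernel of the integral operator; here `a` stands for `4 ν₁`, `b` for `ν₂ ^ Υ`,
`g₁` for `γ₁ / 2` and `g₂` for `γ₂`. Its generating function `∑ c_{s,r} u ^ s v ^ r` is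
`(1 - b v) ^ (-g₂) * (1 - a u / (1 - b v)) ^ (-g₁)`. -/
noncomputable def kerCoeff (a b g₁ g₂ : ℂ) (p : ℕ × ℕ) : ℂ :=
  a ^ p.1 * risingBinom g₁ p.1 * (risingBinom (g₂ + p.1) p.2 * b ^ p.2)

/-- The coefficient arrays for `(g₁, g₂)` and `(-g₁, -g₂)` are inverse to each other for the
two-dimensional Cauchy product. -/
theorem sum_kerCoeff_mul_kerCoeff_neg (a b g₁ g₂ : ℂ) (S R : ℕ) :
    ∑ p ∈ Finset.HasAntidiagonal.antidiagonal S, ∑ q ∈ Finset.HasAntidiagonal.antidiagonal R,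
      kerCoeff a b g₁ g₂ (p.1, q.1) * kerCoeff a b (-g₁) (-g₂) (p.2, q.2)
      = if (S, R) = 0 then 1 else 0 := by
  have h1 : ∀ p ∈ Finset.HasAntidiagonal.antidiagonal S,
      ∑ q ∈ Finset.HasAntidiagonal.antidiagonal R,
      kerCoeff a b g₁ g₂ (p.1, q.1) * kerCoeff a b (-g₁) (-g₂) (p.2, q.2)
      = a ^ S * b ^ R * risingBinom S R * (risingBinom g₁ p.1 * risingBinom (-g₁) p.2) := by
    intro p hp
    have hS := Finset.HasAntidiagonal.mem_antidiagonal.1 hp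
    have h2 : (S : ℂ) = (g₂ + p.1) + (-g₂ + p.2) := by rw [← hS]; push_cast; ring
    rw [h2, risingBinom_add, Finset.mul_sum, Finset.sum_mul]
    refine Finset.sum_congr rfl fun q hq => ?_
    rw [← hS, ← Finset.HasAntidiagonal.mem_antidiagonal.1 hq, kerCoeff, kerCoeff, pow_add,
      pow_add]
    ring
  rw [Finset.sum_congr rfl h1, ← Finset.mul_sum, ← risingBinom_add, add_neg_cancel,
    risingBinom_zero_left]
  rcases Nat.eq_zero_or_pos S with rfl | hS
  · rw [Nat.cast_zero, risingBinom_zero_left]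
    rcases Nat.eq_zero_or_pos R with rfl | hR
    · simp
    · simp [hR.ne']
  · simp [hS.ne']

theorem tsum_kerCoeff_mul_kerCoeff_neg (a b g₁ g₂ : ℂ) (J : ℕ × ℕ → ℂ)
    (h : Summable fun i : (ℕ × ℕ) × (ℕ × ℕ) =>
      kerCoeff a b g₁ g₂ i.1 * kerCoeff a b (-g₁) (-g₂) i.2 * J (i.1 + i.2)) :
    ∑' i : (ℕ × ℕ) × (ℕ × ℕ),
      kerCoeff a b g₁ g₂ i.1 * kerCoeff a b (-g₁) (-g₂) i.2 * J (i.1 + i.2) = J 0 := by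
  have h1 := h.hasSum.tsum_fiberwise (fun i => i.1 + i.2)
  have h2 : ∀ c : ℕ × ℕ, ∑' i : (fun i : (ℕ × ℕ) × (ℕ × ℕ) => i.1 + i.2) ⁻¹' {c},
      kerCoeff a b g₁ g₂ i.1.1 * kerCoeff a b (-g₁) (-g₂) i.1.2 * J (i.1.1 + i.1.2)
      = (if c = 0 then 1 else 0) * J c := by
    rintro ⟨S, R⟩
    rw [← sum_kerCoeff_mul_kerCoeff_neg a b g₁ g₂ S R, ← Finset.sum_product', Finset.sum_mul]
    let e : (ℕ × ℕ) × (ℕ × ℕ) ≃ (ℕ × ℕ) × (ℕ × ℕ) := Equiv.prodProdProdComm ℕ ℕ ℕ ℕ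
    have h3 : (fun i : (ℕ × ℕ) × (ℕ × ℕ) => i.1 + i.2) ⁻¹' {(S, R)} =
        (((Finset.HasAntidiagonal.antidiagonal S ×ˢ Finset.HasAntidiagonal.antidiagonal R).map
          e.toEmbedding : Finset _) : Set ((ℕ × ℕ) × (ℕ × ℕ))) := by
      ext ⟨⟨s, r⟩, ⟨s', r'⟩⟩
      simp [e, Prod.ext_iff]
    rw [h3]
    rw [Finset.tsum_subtype' _ (fun i : (ℕ × ℕ) × (ℕ × ℕ) =>
      kerCoeff a b g₁ g₂ i.1 * kerCoeff a b (-g₁) (-g₂) i.2 * J (i.1 + i.2)), Finset.sum_map]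
    refine Finset.sum_congr rfl fun p hp => ?_
    simp only [Finset.mem_product, Finset.HasAntidiagonal.mem_antidiagonal] at hp
    simp only [e, Equiv.coe_toEmbedding, Equiv.prodProdProdComm_apply, Prod.mk_add_mk, hp.1, hp.2]
  rw [← h1.tsum_eq, tsum_eq_single 0]
  · rw [h2]; simp
  · intro c hc
    rw [h2]; simp [hc]

theorem exists_norm_kerCoeff_le (a b g₁ g₂ : ℂ) :
    ∃ K M : ℝ, 0 ≤ K ∧ 0 ≤ M ∧ ∀ p, ‖kerCoeff a b g₁ g₂ p‖ ≤ K * (M ^ p.1 * M ^ p.2) := by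
  obtain ⟨N₁, h₁⟩ := exists_nat_ge ‖g₁‖
  obtain ⟨N₂, h₂⟩ := exists_nat_ge ‖g₂‖
  refine ⟨2 ^ (N₁ + N₂), 4 * ‖a‖ + 2 * ‖b‖, by positivity, by positivity, fun p => ?_⟩
  have h3 : ‖g₂ + p.1‖ ≤ (N₂ + p.1 : ℕ) := by
    refine (norm_add_le _ _).trans ?_
    rw [Complex.norm_natCast]; push_cast; linarith
  rw [kerCoeff, norm_mul, norm_mul, norm_mul, norm_pow, norm_pow]
  calc _ ≤ ‖a‖ ^ p.1 * 2 ^ (N₁ + p.1) * (2 ^ (N₂ + p.1 + p.2) * ‖b‖ ^ p.2) := by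
        gcongr
        · exact norm_risingBinom_le _ _ _ h₁
        · exact norm_risingBinom_le _ _ _ h3
    _ = 2 ^ (N₁ + N₂) * ((4 * ‖a‖) ^ p.1 * (2 * ‖b‖) ^ p.2) := by
        rw [show 4 * ‖a‖ = ‖a‖ * 2 * 2 by ring, mul_pow, mul_pow, mul_pow]; ring
    _ ≤ _ := by
        gcongr <;> linarith [norm_nonneg a, norm_nonneg b]

/-! ### Decay of the reciprocal Gamma function along an arithmetic progression -/

theorem tendsto_betaIntegral {u v ρ : ℂ} (hu : 0 < u.re) (hv : 0 < v.re) (hρ : 0 < ρ.re) :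
    Tendsto (fun r : ℕ => Complex.betaIntegral (ρ + u * r) v) atTop (𝓝 0) := by
  have hne : ∀ᵐ x : ℝ, x ≠ 1 := by simp [ae_iff, measure_singleton]
  have hcpow : ∀ x ∈ Ioc (0 : ℝ) 1, ∀ r : ℕ, (x : ℂ) ^ (ρ + u * r - 1) * (1 - (x : ℂ)) ^ (v - 1)
      = ((x : ℂ) ^ u) ^ r * ((x : ℂ) ^ (ρ - 1) * (1 - (x : ℂ)) ^ (v - 1)) := by
    intro x hx r
    have hx0 : (x : ℂ) ≠ 0 := by exact_mod_cast hx.1.ne'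
    rw [show ρ + u * r - 1 = u * r + (ρ - 1) by ring, Complex.cpow_add _ _ hx0,
      Complex.cpow_mul_nat, mul_assoc]
  have hdom := (Complex.betaIntegral_convergent hρ hv).norm
  have h0 : (0 : ℂ) = ∫ _x in (0:ℝ)..1, (0 : ℂ) := by simp
  rw [h0]
  refine intervalIntegral.tendsto_integral_filter_of_dominated_convergence _
    (Eventually.of_forall fun r => ?_) (Eventually.of_forall fun r => ?_) hdom ?_
  · have h1 : 0 < (ρ + u * r).re := by simp; positivity
    have := (Complex.betaIntegral_convergent h1 hv).aestronglyMeasurable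
    rwa [uIoc_of_le zero_le_one]
  · refine Eventually.of_forall fun x hx => ?_
    rw [uIoc_of_le zero_le_one] at hx
    rw [hcpow x hx, norm_mul, norm_pow, Complex.norm_cpow_eq_rpow_re_of_pos hx.1]
    exact mul_le_of_le_one_left (norm_nonneg _)
      (pow_le_one₀ (Real.rpow_nonneg hx.1.le _) (Real.rpow_le_one hx.1.le hx.2 hu.le))
  · filter_upwards [hne] with x hx1 hx
    rw [uIoc_of_le zero_le_one] at hx
    simp_rw [hcpow x hx]
    rw [← zero_mul ((x : ℂ) ^ (ρ - 1) * (1 - (x : ℂ)) ^ (v - 1))]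
    refine Tendsto.mul_const _ (tendsto_pow_atTop_nhds_zero_of_norm_lt_one ?_)
    rw [Complex.norm_cpow_eq_rpow_re_of_pos hx.1]
    exact Real.rpow_lt_one hx.1.le (lt_of_le_of_ne hx.2 hx1) hu

/-- The ratio of consecutive terms is `M` times a quotient of Beta integrals
`B(ρ + u r, u) / Γ(u)`, which tends to `0`; no asymptotics of the Gamma function are needed. -/
theorem summable_pow_div_Gamma {u ρ : ℂ} (hu : 0 < u.re) (hρ : 0 < ρ.re) (M : ℝ) (hM : 0 ≤ M) :
    Summable fun r : ℕ => M ^ r / ‖Complex.Gamma (ρ + u * r)‖ := by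
  rcases hM.eq_or_lt with rfl | hM
  · refine summable_of_ne_finset_zero (s := {0}) fun r hr => ?_
    simp at hr
    simp [hr]
  have hre : ∀ r : ℕ, 0 < (ρ + u * r).re := fun r => by
    simp; positivity
  have hG : ∀ r : ℕ, Complex.Gamma (ρ + u * r) ≠ 0 := fun r =>
    Complex.Gamma_ne_zero_of_re_pos (hre r)
  refine summable_of_ratio_test_tendsto_lt_one (l := 0) one_pos
    (Eventually.of_forall fun r => by have := hG r; positivity) ?_
  have h1 := ((tendsto_betaIntegral hu hu hρ).norm.const_mul M).div_const ‖Complex.Gamma u‖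
  simp only [norm_zero, mul_zero, zero_div] at h1
  refine h1.congr fun r => ?_
  have h2 := Complex.Gamma_mul_Gamma_eq_betaIntegral (hre r) hu
  have h3 : ρ + u * (r + 1 : ℕ) = ρ + u * r + u := by push_cast; ring
  have h4 := congrArg norm h2
  rw [norm_mul, norm_mul, ← h3] at h4
  have h5 := norm_pos_iff.2 (hG r)
  have h6 := norm_pos_iff.2 (hG (r + 1))
  have h7 := norm_pos_iff.2 (Complex.Gamma_ne_zero_of_re_pos hu)
  rw [norm_div, norm_div, norm_norm, norm_norm, norm_pow, norm_pow, Real.norm_of_nonneg hM.le,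
    pow_succ]
  field_simp
  linarith

/-! ### Power kernels and the beta integral -/

/-- The kernel `x ^ (α - 1) / Γ(α)` of the Riemann-Liouville integral of order `α`. -/
noncomputable def powKer (α : ℂ) (x : ℝ) : ℂ := (x : ℂ) ^ (α - 1) / Complex.Gamma α

theorem measurable_powKer (α : ℂ) : Measurable (powKer α) :=
  (Complex.measurable_ofReal.pow_const _).div_const _

theorem norm_powKer (α : ℂ) {x : ℝ} (hx : 0 < x) :
    ‖powKer α x‖ = x ^ (α.re - 1) / ‖Complex.Gamma α‖ := by
  rw [powKer, norm_div, Complex.norm_cpow_eq_rpow_re_of_pos hx]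
  simp

theorem powKer_ne_zero {α : ℂ} (hα : 0 < α.re) {x : ℝ} (hx : 0 < x) : powKer α x ≠ 0 := by
  refine div_ne_zero ?_ (Complex.Gamma_ne_zero_of_re_pos hα)
  rw [Ne, Complex.cpow_eq_zero_iff]
  rintro ⟨h, -⟩
  exact hx.ne' (by exact_mod_cast h)

/-- The semigroup property of the Riemann-Liouville kernels. -/
theorem integral_powKer_mul_powKer {a b : ℂ} (ha : 0 < a.re) (hb : 0 < b.re) {x : ℝ} (hx : 0 < x) :
    ∫ t in Ioo 0 x, powKer a t * powKer b (x - t) = powKer (a + b) x := by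
  have h1 := Complex.betaIntegral_scaled a b hx
  have h2 := Complex.Gamma_mul_Gamma_eq_betaIntegral ha hb
  have h3 := Complex.Gamma_ne_zero_of_re_pos ha
  have h4 := Complex.Gamma_ne_zero_of_re_pos hb
  have h5 : Complex.Gamma (a + b) ≠ 0 :=
    Complex.Gamma_ne_zero_of_re_pos (by rw [Complex.add_re]; positivity)
  have h6 : ∀ t : ℝ, powKer a t * powKer b (x - t) =
      (t : ℂ) ^ (a - 1) * ((x : ℂ) - t) ^ (b - 1) / (Complex.Gamma a * Complex.Gamma b) := by
    intro t
    rw [powKer, powKer, div_mul_div_comm, Complex.ofReal_sub]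
  simp_rw [h6]
  rw [integral_div, ← integral_Ioc_eq_integral_Ioo, ← intervalIntegral.integral_of_le hx.le, h1, h2,
    powKer]
  have h7 : Complex.betaIntegral a b ≠ 0 := by
    intro h; rw [h, mul_zero] at h2; exact mul_ne_zero h3 h4 h2
  field_simp

theorem integrableOn_powKer_mul_powKer {a b : ℂ} (ha : 0 < a.re) (hb : 0 < b.re) {x : ℝ}
    (hx : 0 < x) : IntegrableOn (fun t => powKer a t * powKer b (x - t)) (Ioo 0 x) := by
  refine Integrable.of_integral_ne_zero ?_
  rw [integral_powKer_mul_powKer ha hb hx]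
  exact powKer_ne_zero (by rw [Complex.add_re]; positivity) hx

theorem integrableOn_powKer {a : ℂ} (ha : 0 < a.re) {x : ℝ} (hx : 0 < x) :
    IntegrableOn (powKer a) (Ioo 0 x) := by
  refine (integrableOn_powKer_mul_powKer ha (b := 1) (by simp) hx).congr_fun (fun t _ => ?_)
    measurableSet_Ioo
  simp [powKer]

/-- The product of two power kernels, as a kernel on the quadrant. -/
noncomputable def powKer₂ (α β : ℂ) (z : ℝ × ℝ) : ℂ := powKer α z.1 * powKer β z.2

theorem measurable_powKer₂ (α β : ℂ) : Measurable (powKer₂ α β) :=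
  ((measurable_powKer α).comp measurable_fst).mul ((measurable_powKer β).comp measurable_snd)

theorem integrableOn_powKer₂ {a b : ℂ} (ha : 0 < a.re) (hb : 0 < b.re) {z : ℝ × ℝ} (h1 : 0 < z.1)
    (h2 : 0 < z.2) : IntegrableOn (powKer₂ a b) (Ioo 0 z.1 ×ˢ Ioo 0 z.2) := by
  rw [IntegrableOn, Measure.volume_eq_prod, ← Measure.prod_restrict]
  exact (integrableOn_powKer ha h1).mul_prod (integrableOn_powKer hb h2)

theorem integrableOn_powKer₂_mul_powKer₂ {a b c d : ℂ} (ha : 0 < a.re) (hb : 0 < b.re)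
    (hc : 0 < c.re) (hd : 0 < d.re) {z : ℝ × ℝ} (h1 : 0 < z.1) (h2 : 0 < z.2) :
    IntegrableOn (fun q => powKer₂ a b q * powKer₂ c d (z - q)) (Ioo 0 z.1 ×ˢ Ioo 0 z.2) := by
  rw [IntegrableOn, Measure.volume_eq_prod, ← Measure.prod_restrict]
  refine ((integrableOn_powKer_mul_powKer ha hc h1).mul_prod
    (integrableOn_powKer_mul_powKer hb hd h2)).congr (Eventually.of_forall fun q => ?_)
  simp only [powKer₂, Prod.fst_sub, Prod.snd_sub]
  ring

theorem integral_powKer₂_mul_powKer₂ {a b c d : ℂ} (ha : 0 < a.re) (hb : 0 < b.re)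
    (hc : 0 < c.re) (hd : 0 < d.re) {z : ℝ × ℝ} (h1 : 0 < z.1) (h2 : 0 < z.2) :
    ∫ q in Ioo 0 z.1 ×ˢ Ioo 0 z.2, powKer₂ a b q * powKer₂ c d (z - q) =
      powKer₂ (a + c) (b + d) z := by
  rw [powKer₂, ← integral_powKer_mul_powKer ha hc h1, ← integral_powKer_mul_powKer hb hd h2,
    Measure.volume_eq_prod, ← setIntegral_prod_mul]
  refine integral_congr_ae (Eventually.of_forall fun q => ?_)
  simp only [powKer₂, Prod.fst_sub, Prod.snd_sub]
  ring

/-! ### The kernel of the integral operator -/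

/-- The kernel `x ^ (κ - 1) y ^ (ρ - 1) E(ν₁ x, ν₂ y)` of the operator `𝕀`. -/
noncomputable def hkKernel (κ ρ Υ ν₁ ν₂ γ₁ γ₂ : ℂ) (z : ℝ × ℝ) : ℂ :=
  (z.1 : ℂ) ^ (κ - 1) * (z.2 : ℂ) ^ (ρ - 1) *
    hkMittagLeffler κ ρ Υ γ₁ γ₂ ((γ₁ + 1) / 2) γ₂ (ν₁ * (z.1 : ℂ)) (ν₂ * (z.2 : ℂ))

/-- The terms of the expansion of `hkKernel` in power kernels. -/
noncomputable def hkTerm (κ ρ Υ ν₁ ν₂ γ₁ γ₂ : ℂ) (p : ℕ × ℕ) (z : ℝ × ℝ) : ℂ :=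
  kerCoeff (4 * ν₁) (ν₂ ^ Υ) (γ₁ / 2) γ₂ p * powKer₂ (κ + p.1) (ρ + Υ * p.2) z

theorem norm_powKer_add_mul_le {α u : ℂ} (hα : 0 < α.re) (hu : 0 < u.re) (n : ℕ) {x L : ℝ}
    (hx : x ∈ Ioo 0 L) :
    ‖powKer (α + u * n) x‖ ≤
      ‖Complex.Gamma α‖ * ((L ^ u.re) ^ n / ‖Complex.Gamma (α + u * n)‖) * ‖powKer α x‖ := by
  have hG := norm_pos_iff.2 (Complex.Gamma_ne_zero_of_re_pos hα)
  rw [norm_powKer _ hx.1, norm_powKer _ hx.1]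
  have h1 : x ^ ((α + u * n).re - 1) = (x ^ u.re) ^ n * x ^ (α.re - 1) := by
    rw [← Real.rpow_mul_natCast hx.1.le, ← Real.rpow_add hx.1]
    congr 1
    simp; ring
  rw [h1]
  have h2 : (x ^ u.re) ^ n ≤ (L ^ u.re) ^ n :=
    pow_le_pow_left₀ (Real.rpow_nonneg hx.1.le _) (Real.rpow_le_rpow hx.1.le hx.2.le hu.le) n
  have h3 := Real.rpow_nonneg hx.1.le (α.re - 1)
  calc _ ≤ (L ^ u.re) ^ n * x ^ (α.re - 1) / ‖Complex.Gamma (α + u * n)‖ := by gcongr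
    _ = _ := by field_simp

/-- The expansion of the kernel converges absolutely, uniformly on bounded boxes relative to the
leading power kernel. -/
theorem exists_summable_norm_hkTerm_le {κ ρ Υ : ℂ} (hκ : 0 < κ.re) (hρ : 0 < ρ.re) (hΥ : 0 < Υ.re)
    (ν₁ ν₂ γ₁ γ₂ : ℂ) {L M : ℝ} (hL : 0 < L) (hM : 0 < M) :
    ∃ u : ℕ × ℕ → ℝ, Summable u ∧ (∀ p, 0 ≤ u p) ∧ ∀ p, ∀ z ∈ Ioo 0 L ×ˢ Ioo 0 M,
      ‖hkTerm κ ρ Υ ν₁ ν₂ γ₁ γ₂ p z‖ ≤ u p * ‖powKer₂ κ ρ z‖ := by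
  obtain ⟨K, N, hK, hN, hc⟩ := exists_norm_kerCoeff_le (4 * ν₁) (ν₂ ^ Υ) (γ₁ / 2) γ₂
  have hone : (0 : ℝ) < (1 : ℂ).re := by simp
  have s1 := summable_pow_div_Gamma hone hκ (N * L ^ (1 : ℂ).re) (by positivity)
  have s2 := summable_pow_div_Gamma hΥ hρ (N * M ^ Υ.re) (by positivity)
  have s3 := (s1.mul_of_nonneg s2 (fun _ => by positivity) (fun _ => by positivity)).mul_left
    (K * ‖Complex.Gamma κ‖ * ‖Complex.Gamma ρ‖)
  refine ⟨_, s3, fun p => by positivity, fun p z hz => ?_⟩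
  have h1 := norm_powKer_add_mul_le hκ hone p.1 hz.1
  have h2 := norm_powKer_add_mul_le hρ hΥ p.2 hz.2
  rw [one_mul] at h1
  rw [hkTerm, powKer₂, powKer₂, norm_mul, norm_mul, norm_mul]
  calc _ ≤ K * (N ^ p.1 * N ^ p.2) *
        ((‖Complex.Gamma κ‖ * ((L ^ (1 : ℂ).re) ^ p.1 / ‖Complex.Gamma (κ + p.1)‖) *
          ‖powKer κ z.1‖)
        * (‖Complex.Gamma ρ‖ * ((M ^ Υ.re) ^ p.2 / ‖Complex.Gamma (ρ + Υ * p.2)‖) *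
          ‖powKer ρ z.2‖)) := by
        gcongr
        exact hc p
    _ = _ := by
        rw [one_mul, mul_pow, mul_pow]; ring

theorem hasSum_hkTerm {κ ρ Υ : ℂ} (hκ : 0 < κ.re) (hρ : 0 < ρ.re) (hΥ : 0 < Υ.re)
    (ν₁ ν₂ γ₁ γ₂ : ℂ) {z : ℝ × ℝ} (h1 : 0 < z.1) (h2 : 0 < z.2) :
    HasSum (fun p => hkTerm κ ρ Υ ν₁ ν₂ γ₁ γ₂ p z) (hkKernel κ ρ Υ ν₁ ν₂ γ₁ γ₂ z) := by
  obtain ⟨u, hu, -, hb⟩ := exists_summable_norm_hkTerm_le hκ hρ hΥ ν₁ ν₂ γ₁ γ₂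
    (L := z.1 + 1) (M := z.2 + 1) (by positivity) (by positivity)
  have hs : Summable fun p => hkTerm κ ρ Υ ν₁ ν₂ γ₁ γ₂ p z :=
    Summable.of_norm_bounded (hu.mul_right _) fun p => hb p z ⟨⟨h1, by simp⟩, ⟨h2, by simp⟩⟩
  convert! hs.hasSum using 1
  have hz1 : (z.1 : ℂ) ≠ 0 := by exact_mod_cast h1.ne'
  have hz2 : (z.2 : ℂ) ≠ 0 := by exact_mod_cast h2.ne'
  rw [hs.tsum_prod, hkKernel, hkMittagLeffler, ← tsum_mul_left]
  refine tsum_congr fun s => ?_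
  rw [← tsum_mul_left]
  refine tsum_congr fun r => ?_
  have e1 : (z.1 : ℂ) ^ (κ + s - 1) = (z.1 : ℂ) ^ (κ - 1) * (z.1 : ℂ) ^ s := by
    rw [← Complex.cpow_natCast, ← Complex.cpow_add _ _ hz1]; congr 1; ring
  have e2 : (z.2 : ℂ) ^ (ρ + Υ * r - 1) = (z.2 : ℂ) ^ (ρ - 1) * ((z.2 : ℂ) ^ Υ) ^ r := by
    rw [← Complex.cpow_mul_nat, ← Complex.cpow_add _ _ hz2]; congr 1; ring
  have e3 : (ν₂ * (z.2 : ℂ)) ^ (Υ * r) = (ν₂ ^ Υ) ^ r * ((z.2 : ℂ) ^ Υ) ^ r := by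
    have hΥ0 : Υ ≠ 0 := by rintro rfl; simp at hΥ
    rw [Complex.cpow_mul_nat, ← mul_pow]
    congr 1
    rcases eq_or_ne ν₂ 0 with rfl | hν
    · simp [hΥ0]
    · rw [mul_comm, Complex.cpow_def_of_ne_zero (mul_ne_zero hz2 hν),
        Complex.cpow_def_of_ne_zero hν, Complex.cpow_def_of_ne_zero hz2,
        Complex.log_ofReal_mul h2 hν, ← Complex.exp_add, ← Complex.ofReal_log h2.le]
      congr 1; ring
  rw [hkCoeff_family, e3, hkTerm, kerCoeff, powKer₂, powKer, powKer, e1, e2, risingBinom,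
    risingBinom]
  ring

theorem exists_norm_hkKernel_le {κ ρ Υ : ℂ} (hκ : 0 < κ.re) (hρ : 0 < ρ.re) (hΥ : 0 < Υ.re)
    (ν₁ ν₂ γ₁ γ₂ : ℂ) {L M : ℝ} (hL : 0 < L) (hM : 0 < M) :
    ∃ K : ℝ, ∀ z ∈ Ioo 0 L ×ˢ Ioo 0 M,
      ‖hkKernel κ ρ Υ ν₁ ν₂ γ₁ γ₂ z‖ ≤ K * ‖powKer₂ κ ρ z‖ := by
  obtain ⟨u, hu, -, hb⟩ := exists_summable_norm_hkTerm_le hκ hρ hΥ ν₁ ν₂ γ₁ γ₂ hL hM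
  refine ⟨∑' p, u p, fun z hz => ?_⟩
  rw [← (hasSum_hkTerm hκ hρ hΥ ν₁ ν₂ γ₁ γ₂ hz.1.1 hz.2.1).tsum_eq, ← tsum_mul_right]
  exact tsum_of_norm_bounded (hu.mul_right _).hasSum fun p => hb p z hz

theorem integrableOn_hkKernel {κ ρ Υ : ℂ} (hκ : 0 < κ.re) (hρ : 0 < ρ.re) (hΥ : 0 < Υ.re)
    (ν₁ ν₂ γ₁ γ₂ : ℂ) {L M : ℝ} (hL : 0 < L) (hM : 0 < M) :
    IntegrableOn (hkKernel κ ρ Υ ν₁ ν₂ γ₁ γ₂) (Ioo 0 L ×ˢ Ioo 0 M) := by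
  obtain ⟨K, hK⟩ := exists_norm_hkKernel_le hκ hρ hΥ ν₁ ν₂ γ₁ γ₂ hL hM
  have hm : MeasurableSet (Ioo 0 L ×ˢ Ioo 0 M) := measurableSet_Ioo.prod measurableSet_Ioo
  refine ((integrableOn_powKer₂ hκ hρ (z := (L, M)) hL hM).norm.const_mul K).mono' ?_
    ((ae_restrict_iff' hm).2 (Eventually.of_forall hK))
  refine aestronglyMeasurable_of_tendsto_ae (atTop : Filter (Finset (ℕ × ℕ)))
    (f := fun S z => ∑ p ∈ S, hkTerm κ ρ Υ ν₁ ν₂ γ₁ γ₂ p z) (fun S => ?_)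
    ((ae_restrict_iff' hm).2 (Eventually.of_forall fun z hz =>
      hasSum_hkTerm hκ hρ hΥ ν₁ ν₂ γ₁ γ₂ hz.1.1 hz.2.1))
  exact (Finset.measurable_sum S fun p _ =>
    (measurable_powKer₂ _ _).const_mul _).aestronglyMeasurable

/-- The kernels for `(γ₁, γ₂)` and `(-γ₁, -γ₂)` convolve to a pure power kernel: termwise, the
convolution adds the exponents, so that the coefficients form a Cauchy product. -/
theorem integral_hkKernel_mul_hkKernel_neg {κ ρ σ η Υ : ℂ} (hκ : 0 < κ.re) (hρ : 0 < ρ.re)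
    (hσ : 0 < σ.re) (hη : 0 < η.re) (hΥ : 0 < Υ.re) (ν₁ ν₂ γ₁ γ₂ : ℂ) {z : ℝ × ℝ}
    (h1 : 0 < z.1) (h2 : 0 < z.2) :
    ∫ q in Ioo 0 z.1 ×ˢ Ioo 0 z.2,
      hkKernel κ ρ Υ ν₁ ν₂ γ₁ γ₂ q * hkKernel σ η Υ ν₁ ν₂ (-γ₁) (-γ₂) (z - q) =
      powKer₂ (κ + σ) (ρ + η) z := by
  obtain ⟨u, hu, hu0, hub⟩ := exists_summable_norm_hkTerm_le hκ hρ hΥ ν₁ ν₂ γ₁ γ₂ h1 h2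
  obtain ⟨v, hv, hv0, hvb⟩ := exists_summable_norm_hkTerm_le hσ hη hΥ ν₁ ν₂ (-γ₁) (-γ₂) h1 h2
  set Q : Set (ℝ × ℝ) := Ioo 0 z.1 ×ˢ Ioo 0 z.2
  have hm : MeasurableSet Q := measurableSet_Ioo.prod measurableSet_Ioo
  have hsub : ∀ q ∈ Q, z - q ∈ Q := fun q hq =>
    ⟨⟨sub_pos.2 hq.1.2, sub_lt_self _ hq.1.1⟩, ⟨sub_pos.2 hq.2.2, sub_lt_self _ hq.2.1⟩⟩
  let F : (ℕ × ℕ) × (ℕ × ℕ) → ℝ × ℝ → ℂ := fun i q =>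
    hkTerm κ ρ Υ ν₁ ν₂ γ₁ γ₂ i.1 q * hkTerm σ η Υ ν₁ ν₂ (-γ₁) (-γ₂) i.2 (z - q)
  have hpos : ∀ (a u : ℂ) (n : ℕ), 0 < a.re → 0 < u.re → 0 < (a + u * n).re := fun a u n ha hu => by
    simp; positivity
  have hpos1 : ∀ (a : ℂ) (n : ℕ), 0 < a.re → 0 < (a + n).re := fun a n ha => by
    simp; positivity
  have hFeq : ∀ i q, F i q = kerCoeff (4 * ν₁) (ν₂ ^ Υ) (γ₁ / 2) γ₂ i.1 *
      kerCoeff (4 * ν₁) (ν₂ ^ Υ) (-(γ₁ / 2)) (-γ₂) i.2 *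
      (powKer₂ (κ + i.1.1) (ρ + Υ * i.1.2) q * powKer₂ (σ + i.2.1) (η + Υ * i.2.2) (z - q)) := by
    intro i q
    simp only [F, hkTerm, neg_div]
    ring
  have hFint : ∀ i, Integrable (F i) (volume.restrict Q) := fun i => by
    rw [show F i = _ from funext (hFeq i)]
    exact (integrableOn_powKer₂_mul_powKer₂ (hpos1 _ _ hκ) (hpos _ _ _ hρ hΥ) (hpos1 _ _ hσ)
      (hpos _ _ _ hη hΥ) h1 h2).const_mul _
  have hFval : ∀ i, ∫ q in Q, F i q = kerCoeff (4 * ν₁) (ν₂ ^ Υ) (γ₁ / 2) γ₂ i.1 *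
      kerCoeff (4 * ν₁) (ν₂ ^ Υ) (-(γ₁ / 2)) (-γ₂) i.2 *
      powKer₂ (κ + σ + ((i.1 + i.2).1 : ℕ)) (ρ + η + Υ * ((i.1 + i.2).2 : ℕ)) z := fun i => by
    simp_rw [hFeq]
    rw [integral_const_mul, integral_powKer₂_mul_powKer₂ (hpos1 _ _ hκ) (hpos _ _ _ hρ hΥ)
      (hpos1 _ _ hσ) (hpos _ _ _ hη hΥ) h1 h2]
    congr 2 <;> (simp only [Prod.fst_add, Prod.snd_add]; push_cast; ring)
  have hW := (integrableOn_powKer₂_mul_powKer₂ hκ hρ hσ hη h1 h2).norm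
  have hFsum : Summable fun i => ∫ q in Q, ‖F i q‖ := by
    refine Summable.of_nonneg_of_le (fun i => integral_nonneg fun q => norm_nonneg _) (fun i => ?_)
      ((hu.mul_of_nonneg hv hu0 hv0).mul_right
        (∫ q in Q, ‖powKer₂ κ ρ q * powKer₂ σ η (z - q)‖))
    rw [← integral_const_mul]
    refine setIntegral_mono_on (hFint i).norm (hW.const_mul _) hm fun q hq => ?_
    rw [norm_mul, norm_mul]
    calc _ ≤ (u i.1 * ‖powKer₂ κ ρ q‖) * (v i.2 * ‖powKer₂ σ η (z - q)‖) :=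
          mul_le_mul (hub _ _ hq) (hvb _ _ (hsub q hq)) (norm_nonneg _)
            (mul_nonneg (hu0 _) (norm_nonneg _))
      _ = _ := by ring
  have hmain := hasSum_integral_of_summable_integral_norm hFint hFsum
  simp_rw [hFval] at hmain
  have hres := tsum_kerCoeff_mul_kerCoeff_neg (4 * ν₁) (ν₂ ^ Υ) (γ₁ / 2) γ₂
    (fun c => powKer₂ (κ + σ + (c.1 : ℕ)) (ρ + η + Υ * (c.2 : ℕ)) z) hmain.summable
  rw [hmain.tsum_eq] at hres
  simp only [Prod.fst_zero, Prod.snd_zero, Nat.cast_zero, mul_zero, add_zero] at hres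
  have hker : ∀ q ∈ Q, hkKernel κ ρ Υ ν₁ ν₂ γ₁ γ₂ q * hkKernel σ η Υ ν₁ ν₂ (-γ₁) (-γ₂) (z - q) =
      ∑' i, F i q := fun q hq => by
    have hs := hasSum_hkTerm hκ hρ hΥ ν₁ ν₂ γ₁ γ₂ hq.1.1 hq.2.1
    have hs' := hasSum_hkTerm hσ hη hΥ ν₁ ν₂ (-γ₁) (-γ₂) (hsub q hq).1.1 (hsub q hq).2.1
    have hss := summable_mul_of_summable_norm hs.summable.norm hs'.summable.norm
    exact (hs.mul hs' hss).tsum_eq.symm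
  exact (setIntegral_congr_fun hm hker).trans hres

/-! ### Volterra convolution on rectangles -/

/-- The open rectangle `(a, b) × (c, d)`. -/
abbrev openBox (a b c d : ℝ) : Set (ℝ × ℝ) := Ioo a b ×ˢ Ioo c d

theorem measurableSet_openBox {a b c d : ℝ} : MeasurableSet (openBox a b c d) :=
  measurableSet_Ioo.prod measurableSet_Ioo

open ContinuousLinearMap in
/-- The convolution on the plane of a function on the rectangle `R` and a kernel on the rectangle
`Q`, both extended by zero. -/
noncomputable def boxConv (R Q : Set (ℝ × ℝ)) (g k : ℝ × ℝ → ℂ) : ℝ × ℝ → ℂ :=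
  convolution (R.indicator g) (Q.indicator k) (mul ℝ ℂ) volume

theorem boxConv_apply (R Q : Set (ℝ × ℝ)) (g k : ℝ × ℝ → ℂ) (p : ℝ × ℝ) :
    boxConv R Q g k p = ∫ q, R.indicator g q * Q.indicator k (p - q) := rfl

/-- For `p` below the upper right corner of the rectangle, the truncations restrict the convolution
integral to the points between the lower left corner and `p`. -/
theorem indicator_mul_indicator_sub {𝕜 : Type*} [MulZeroClass 𝕜] {A B C D L M : ℝ}
    (hL : B - A ≤ L) (hM : D - C ≤ M)
    (g k : ℝ × ℝ → 𝕜) {p : ℝ × ℝ} (h1 : p.1 ≤ B) (h2 : p.2 ≤ D) (q : ℝ × ℝ) :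
    (openBox A B C D).indicator g q * (openBox 0 L 0 M).indicator k (p - q) =
      (openBox A p.1 C p.2).indicator (fun q => g q * k (p - q)) q := by
  by_cases hq : q ∈ openBox A p.1 C p.2
  · obtain ⟨⟨a1, a2⟩, a3, a4⟩ := hq
    rw [indicator_of_mem, indicator_of_mem, indicator_of_mem]
    · exact ⟨⟨a1, a2⟩, a3, a4⟩
    · exact ⟨⟨sub_pos.2 a2, by simp only [Prod.fst_sub]; linarith⟩,
        ⟨sub_pos.2 a4, by simp only [Prod.snd_sub]; linarith⟩⟩
    · exact ⟨⟨a1, by linarith⟩, a3, by linarith⟩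
  · rw [indicator_of_notMem hq]
    by_cases hR : q ∈ openBox A B C D
    · have : p - q ∉ openBox 0 L 0 M := fun h =>
        hq ⟨⟨hR.1.1, sub_pos.1 h.1.1⟩, ⟨hR.2.1, sub_pos.1 h.2.1⟩⟩
      rw [indicator_of_notMem this, mul_zero]
    · rw [indicator_of_notMem hR, zero_mul]

section

variable {A B C D : ℝ}

local notation "𝓡" => openBox A B C D
local notation "𝓠" => openBox 0 (B - A) 0 (D - C)

/-- The convolution over `Q` of two kernels on `Q` at a point which is not above the upper right
corner of `Q`. -/
theorem boxConv_self {L M : ℝ} (k k' : ℝ × ℝ → ℂ) {z : ℝ × ℝ} (h1 : z.1 ≤ L) (h2 : z.2 ≤ M) :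
    boxConv (openBox 0 L 0 M) (openBox 0 L 0 M) k k' z =
      ∫ q in openBox 0 z.1 0 z.2, k q * k' (z - q) := by
  rw [boxConv_apply, ← integral_indicator measurableSet_openBox]
  exact integral_congr_ae (Eventually.of_forall fun q =>
    indicator_mul_indicator_sub (by simp) (by simp) k k' h1 h2 q)

theorem intervalIntegral_eq_boxConv {g k : ℝ × ℝ → ℂ} {p : ℝ × ℝ} (hp : p ∈ 𝓡)
    (hi : Integrable fun q => (𝓡).indicator g q * (𝓠).indicator k (p - q)) :
    ∫ w in C..p.2, ∫ t in A..p.1, k (p.1 - t, p.2 - w) * g (t, w) = boxConv 𝓡 𝓠 g k p := by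
  have h := indicator_mul_indicator_sub (le_refl (B - A)) (le_refl (D - C)) g k hp.1.2.le hp.2.2.le
  rw [boxConv_apply]
  simp_rw [h] at hi ⊢
  rw [integrable_indicator_iff measurableSet_openBox] at hi
  rw [integral_indicator measurableSet_openBox]
  rw [IntegrableOn, Measure.volume_eq_prod, ← Measure.prod_restrict] at hi
  rw [Measure.volume_eq_prod, ← Measure.prod_restrict, integral_prod_symm _ hi,
    intervalIntegral.integral_of_le hp.2.1.le, integral_Ioc_eq_integral_Ioo]
  refine integral_congr_ae (Eventually.of_forall fun w => ?_)
  simp only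
  rw [intervalIntegral.integral_of_le hp.1.1.le, integral_Ioc_eq_integral_Ioo]
  exact integral_congr_ae (Eventually.of_forall fun t => mul_comm _ _)

theorem boxConv_congr_ae {R Q : Set (ℝ × ℝ)} (hR : MeasurableSet R) {g g' k : ℝ × ℝ → ℂ}
    (h : g =ᵐ[volume.restrict R] g') : boxConv R Q g k = boxConv R Q g' k := by
  ext p
  rw [boxConv_apply, boxConv_apply]
  refine integral_congr_ae ?_
  filter_upwards [(ae_restrict_iff' hR).1 h] with q hq
  by_cases hqR : q ∈ R
  · simp only [indicator_of_mem hqR, hq hqR]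
  · simp only [indicator_of_notMem hqR]

theorem integrable_boxConv {R Q : Set (ℝ × ℝ)} (hR : MeasurableSet R) (hQ : MeasurableSet Q)
    {g k : ℝ × ℝ → ℂ} (hg : IntegrableOn g R) (hk : IntegrableOn k Q) :
    Integrable (boxConv R Q g k) :=
  (hg.integrable_indicator hR).integrable_convolution _ (hk.integrable_indicator hQ)

theorem ae_intervalIntegral_eq_boxConv {g k : ℝ × ℝ → ℂ} (hg : IntegrableOn g 𝓡)
    (hk : IntegrableOn k 𝓠) :
    ∀ᵐ p ∂(volume.restrict 𝓡),
      ∫ w in C..p.2, ∫ t in A..p.1, k (p.1 - t, p.2 - w) * g (t, w) = boxConv 𝓡 𝓠 g k p := by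
  rw [ae_restrict_iff' measurableSet_openBox]
  filter_upwards [(hg.integrable_indicator measurableSet_openBox).ae_convolution_exists
    (ContinuousLinearMap.mul ℝ ℂ) (hk.integrable_indicator measurableSet_openBox)] with p hp hpR
  exact intervalIntegral_eq_boxConv hpR hp

theorem boxConv_eq_zero {g k : ℝ × ℝ → ℂ} {p : ℝ × ℝ} (h : ¬ (A < p.1 ∧ C < p.2)) :
    boxConv 𝓡 𝓠 g k p = 0 := by
  rw [boxConv_apply]
  refine integral_eq_zero_of_ae (Eventually.of_forall fun q => ?_)
  by_cases hq : q ∈ 𝓡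
  · have : p - q ∉ 𝓠 := fun hz =>
      h ⟨hq.1.1.trans (sub_pos.1 hz.1.1), hq.2.1.trans (sub_pos.1 hz.2.1)⟩
    simp [indicator_of_notMem this]
  · simp [indicator_of_notMem hq]

/-- Below the upper right corner of the rectangle, cutting off the inner convolution outside the
rectangle does not change an iterated convolution. -/
theorem indicator_boxConv_mul {g k k' : ℝ × ℝ → ℂ} {p : ℝ × ℝ} (hp : p ∈ 𝓡)
    (q : ℝ × ℝ) :
    (𝓡).indicator (boxConv 𝓡 𝓠 g k) q * (𝓠).indicator k' (p - q) =
      boxConv 𝓡 𝓠 g k q * (𝓠).indicator k' (p - q) := by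
  by_cases hq : q ∈ 𝓡
  · rw [indicator_of_mem hq]
  · rw [indicator_of_notMem hq, zero_mul]
    by_cases hz : p - q ∈ 𝓠
    · rw [boxConv_eq_zero, zero_mul]
      rintro ⟨h1, h2⟩
      exact hq ⟨⟨h1, (sub_pos.1 hz.1.1).trans hp.1.2⟩, ⟨h2, (sub_pos.1 hz.2.1).trans hp.2.2⟩⟩
    · rw [indicator_of_notMem hz, mul_zero]

/-- If two kernels convolve to `J` on `Q`, then convolving with the one and then with the other
kernel amounts to convolving with `J`. This combines `convolution_assoc` with the support
properties. -/
theorem convolution_boxConv_eq {g k k' J : ℝ × ℝ → ℂ} {p : ℝ × ℝ} (hp : p ∈ 𝓡)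
    (hJ : ∀ z ∈ 𝓠, ∫ q in openBox 0 z.1 0 z.2, k q * k' (z - q) = J z) :
    ∫ q, (𝓡).indicator g q * boxConv 𝓠 𝓠 k k' (p - q) =
      boxConv 𝓡 𝓠 g J p := by
  rw [boxConv_apply]
  refine integral_congr_ae (Eventually.of_forall fun q => ?_)
  by_cases hq : q ∈ 𝓡
  · have h1 : (p - q).1 ≤ B - A := by simp only [Prod.fst_sub]; linarith [hp.1.2, hq.1.1]
    have h2 : (p - q).2 ≤ D - C := by simp only [Prod.snd_sub]; linarith [hp.2.2, hq.2.1]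
    simp only
    rw [boxConv_self _ _ h1 h2]
    by_cases hz : p - q ∈ 𝓠
    · rw [hJ _ hz, indicator_of_mem hz]
    · rw [indicator_of_notMem hz]
      have : openBox 0 (p - q).1 0 (p - q).2 = ∅ := by
        refine eq_empty_of_forall_notMem fun x hx => hz ⟨⟨hx.1.1.trans hx.1.2, ?_⟩,
          ⟨hx.2.1.trans hx.2.2, ?_⟩⟩
        · simp only [Prod.fst_sub]; linarith [hp.1.2, hq.1.1]
        · simp only [Prod.snd_sub]; linarith [hp.2.2, hq.2.1]
      rw [this]; simp
  · simp [indicator_of_notMem hq]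

theorem ae_boxConv_boxConv {g k k' J : ℝ × ℝ → ℂ} (hg : IntegrableOn g 𝓡)
    (hk : IntegrableOn k 𝓠) (hk' : IntegrableOn k' 𝓠)
    (hJ : ∀ z ∈ 𝓠, ∫ q in openBox 0 z.1 0 z.2, k q * k' (z - q) = J z) :
    ∀ᵐ p ∂(volume.restrict 𝓡),
      boxConv 𝓡 𝓠 (boxConv 𝓡 𝓠 g k) k' p = boxConv 𝓡 𝓠 g J p := by
  rw [ae_restrict_iff' measurableSet_openBox]
  have hg' := hg.integrable_indicator measurableSet_openBox
  have hk1 := hk.integrable_indicator measurableSet_openBox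
  have hk2 := hk'.integrable_indicator measurableSet_openBox
  have e1 := hg'.ae_convolution_exists (ContinuousLinearMap.mul ℝ ℂ) hk1
  have e2 := hk1.norm.ae_convolution_exists (ContinuousLinearMap.mul ℝ ℝ) hk2.norm
  have e3 := hg'.norm.ae_convolution_exists (ContinuousLinearMap.mul ℝ ℝ)
    (hk1.norm.integrable_convolution (ContinuousLinearMap.mul ℝ ℝ) hk2.norm)
  filter_upwards [e3] with p hp hpR
  have h := convolution_assoc (ContinuousLinearMap.mul ℝ ℂ) (ContinuousLinearMap.mul ℝ ℂ)
    (ContinuousLinearMap.mul ℝ ℂ) (ContinuousLinearMap.mul ℝ ℂ) (fun x y z => mul_assoc x y z)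
    hg'.1 hk1.1 hk2.1 e1 e2 hp
  rw [← convolution_boxConv_eq hpR hJ]
  refine Eq.trans ?_ h
  rw [boxConv_apply]
  exact integral_congr_ae (Eventually.of_forall fun q => indicator_boxConv_mul hpR q)

/-- A pointwise version of `ae_boxConv_boxConv`, for kernels whose absolute values have a bounded
convolution. -/
theorem boxConv_boxConv_of_bounded {g k k' J : ℝ × ℝ → ℂ} (hg : IntegrableOn g 𝓡)
    (hk : IntegrableOn k 𝓠) (hk' : IntegrableOn k' 𝓠)
    (hJ : ∀ z ∈ 𝓠, ∫ q in openBox 0 z.1 0 z.2, k q * k' (z - q) = J z)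
    (hint : ∀ z ∈ 𝓠, IntegrableOn (fun q => k q * k' (z - q)) (openBox 0 z.1 0 z.2))
    {K : ℝ} (hK : ∀ z ∈ 𝓠, ∫ q in openBox 0 z.1 0 z.2, ‖k q * k' (z - q)‖ ≤ K)
    {p : ℝ × ℝ} (hp : p ∈ 𝓡) :
    Integrable (fun q => (𝓡).indicator (boxConv 𝓡 𝓠 g k) q * (𝓠).indicator k' (p - q)) ∧
      boxConv 𝓡 𝓠 (boxConv 𝓡 𝓠 g k) k' p = boxConv 𝓡 𝓠 g J p := by
  have hg' := hg.integrable_indicator measurableSet_openBox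
  have hk1 := hk.integrable_indicator measurableSet_openBox
  have hk2 := hk'.integrable_indicator measurableSet_openBox
  set φ := (𝓡).indicator g with hφ
  set k₁ := (𝓠).indicator k with hk₁
  set k₂ := (𝓠).indicator k' with hk₂
  have e1 := hg'.ae_convolution_exists (ContinuousLinearMap.mul ℝ ℂ) hk1
  have e2 := hk1.ae_convolution_exists (ContinuousLinearMap.mul ℝ ℂ) hk2
  -- For `y` in the rectangle the inner integrand is supported in a box on which `hint`, `hK` apply.
  have hinner : ∀ y ∈ 𝓡, Integrable (fun x => k₁ x * k₂ (p - y - x)) ∧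
      ∫ x, ‖k₁ x * k₂ (p - y - x)‖ ≤ max K 0 := by
    intro y hy
    have h1 : (p - y).1 < B - A := by simp only [Prod.fst_sub]; linarith [hp.1.2, hy.1.1]
    have h2 : (p - y).2 < D - C := by simp only [Prod.snd_sub]; linarith [hp.2.2, hy.2.1]
    have h3 := indicator_mul_indicator_sub (sub_zero (B - A)).le (sub_zero (D - C)).le k k'
      h1.le h2.le
    simp_rw [hk₁, hk₂, h3]
    simp_rw [norm_indicator_eq_indicator_norm]
    rw [integrable_indicator_iff measurableSet_openBox, integral_indicator measurableSet_openBox]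
    by_cases hz : p - y ∈ 𝓠
    · exact ⟨hint _ hz, (hK _ hz).trans (le_max_left _ _)⟩
    · have h4 : openBox 0 (p - y).1 0 (p - y).2 = ∅ :=
        eq_empty_of_forall_notMem fun x hx => hz ⟨⟨hx.1.1.trans hx.1.2, h1⟩,
          ⟨hx.2.1.trans hx.2.2, h2⟩⟩
      rw [h4]
      simp
  have h_meas : AEStronglyMeasurable (Function.uncurry fun x y => φ y * (k₁ x * k₂ (p - y - x)))
      ((volume : Measure (ℝ × ℝ)).prod (volume : Measure (ℝ × ℝ))) := by
    refine hg'.1.comp_snd.mul (hk1.1.comp_fst.mul ?_)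
    refine (hk2.1.mono_ac ?_).comp_measurable (by fun_prop)
    refine Measure.QuasiMeasurePreserving.absolutelyContinuous ?_
    refine QuasiMeasurePreserving.prod_of_left (by fun_prop)
      (Eventually.of_forall fun y => ?_)
    dsimp only
    exact quasiMeasurePreserving_sub_left_of_right_invariant volume _
  have h3 : Measure.map (fun z : (ℝ × ℝ) × (ℝ × ℝ) => (z.1 - z.2, z.2)) (volume.prod volume) =
      volume.prod volume := (measurePreserving_sub_prod volume volume).map_eq
  have hi0 : Integrable (Function.uncurry fun x y => φ y * (k₁ x * k₂ (p - y - x)))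
      ((volume : Measure (ℝ × ℝ)).prod (volume : Measure (ℝ × ℝ))) := by
    rw [integrable_prod_iff' h_meas]
    constructor
    · refine Eventually.of_forall fun y => ?_
      by_cases hy : y ∈ 𝓡
      · exact (hinner y hy).1.const_mul (φ y)
      · simp [hφ, indicator_of_notMem hy]
    · refine (hg'.norm.mul_const (max K 0)).mono' h_meas.prod_swap.norm.integral_prod_right'
        (Eventually.of_forall fun y => ?_)
      rw [Real.norm_of_nonneg (integral_nonneg fun _ => norm_nonneg _)]
      by_cases hy : y ∈ 𝓡
      · simp only [Function.uncurry_apply_pair, norm_mul (φ y), integral_const_mul]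
        exact mul_le_mul_of_nonneg_left (hinner y hy).2 (norm_nonneg _)
      · simp [hφ, indicator_of_notMem hy]
  have hi : Integrable (Function.uncurry fun x y => φ y * (k₁ (x - y) * k₂ (p - x)))
      ((volume : Measure (ℝ × ℝ)).prod (volume : Measure (ℝ × ℝ))) := by
    rw [← h3] at hi0
    convert! hi0.comp_measurable (measurable_sub.prodMk measurable_snd)
    ext ⟨x, y⟩
    simp +unfoldPartialApp only [Function.uncurry, Function.comp_apply, sub_sub_sub_cancel_right]
  have hcut : ∀ q, (𝓡).indicator (boxConv 𝓡
      𝓠 g k) q * k₂ (p - q) =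
      boxConv 𝓡 𝓠 g k q * k₂ (p - q) :=
    fun q => indicator_boxConv_mul hp q
  simp_rw [hcut]
  constructor
  · refine hi.integral_prod_left.congr (Eventually.of_forall fun x => ?_)
    simp only [Function.uncurry_apply_pair]
    simp_rw [← mul_assoc]
    rw [integral_mul_const]
    rfl
  · have h := convolution_assoc' (ContinuousLinearMap.mul ℝ ℂ) (ContinuousLinearMap.mul ℝ ℂ)
      (ContinuousLinearMap.mul ℝ ℂ) (ContinuousLinearMap.mul ℝ ℂ) (fun x y z => mul_assoc x y z)
      e1 e2 hi
    rw [← convolution_boxConv_eq hp hJ]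
    refine Eq.trans ?_ h
    rw [boxConv_apply]
    exact integral_congr_ae (Eventually.of_forall fun q => indicator_boxConv_mul hp q)

end

/-! ### Repeated integrals and their classical derivatives -/

/-- The truncated power `x ↦ x₊ ^ n / n!`, the kernel of the `(n + 1)`-fold repeated integral. -/
noncomputable def truncPow (n : ℕ) (x : ℝ) : ℝ := if 0 < x then x ^ n / n.factorial else 0

theorem truncPow_of_pos (n : ℕ) {x : ℝ} (hx : 0 < x) : truncPow n x = x ^ n / n.factorial :=
  if_pos hx

theorem truncPow_of_nonpos (n : ℕ) {x : ℝ} (hx : x ≤ 0) : truncPow n x = 0 := if_neg hx.not_gt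

theorem truncPow_nonneg (n : ℕ) (x : ℝ) : 0 ≤ truncPow n x := by
  unfold truncPow; split_ifs <;> positivity

theorem monotone_truncPow (n : ℕ) : Monotone (truncPow n) := by
  intro x y hxy
  rcases le_or_gt x 0 with hx | hx
  · rw [truncPow_of_nonpos n hx]; exact truncPow_nonneg n y
  · rw [truncPow_of_pos n hx, truncPow_of_pos n (hx.trans_le hxy)]
    gcongr

theorem measurable_truncPow (n : ℕ) : Measurable (truncPow n) := (monotone_truncPow n).measurable

theorem hasDerivAt_truncPow_succ (n : ℕ) {x : ℝ} (hx : x ≠ 0) :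
    HasDerivAt (truncPow (n + 1)) (truncPow n x) x := by
  rcases hx.lt_or_gt with h | h
  · rw [truncPow_of_nonpos n h.le]
    refine (hasDerivAt_const x (0 : ℝ)).congr_of_eventuallyEq ?_
    filter_upwards [Iio_mem_nhds h] with y hy
    rw [truncPow_of_nonpos _ (le_of_lt hy)]
  · rw [truncPow_of_pos n h]
    have h1 := (hasDerivAt_pow (n + 1) x).div_const ((n + 1).factorial : ℝ)
    have h2 : ((n + 1 : ℕ) : ℝ) * x ^ (n + 1 - 1) / ((n + 1).factorial : ℝ) =
        x ^ n / n.factorial := by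
      rw [Nat.factorial_succ]; push_cast
      have : (n.factorial : ℝ) ≠ 0 := by exact_mod_cast n.factorial_ne_zero
      field_simp
    rw [h2] at h1
    refine h1.congr_of_eventuallyEq ?_
    filter_upwards [Ioi_mem_nhds h] with y hy
    rw [truncPow_of_pos _ hy]

theorem truncPow_succ_eq (n : ℕ) (x : ℝ) :
    truncPow (n + 1) x = max x 0 ^ (n + 1) / (n + 1).factorial := by
  rcases le_or_gt x 0 with hx | hx
  · rw [truncPow_of_nonpos _ hx, max_eq_right hx]; simp
  · rw [truncPow_of_pos _ hx, max_eq_left hx.le]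

theorem abs_truncPow_succ_sub_le (n : ℕ) {x y b : ℝ} (hb : 0 ≤ b) (hx : x ≤ b) (hy : y ≤ b) :
    |truncPow (n + 1) x - truncPow (n + 1) y| ≤ b ^ n / n.factorial * |x - y| := by
  have hf : (0 : ℝ) < n.factorial := by positivity
  rw [truncPow_succ_eq, truncPow_succ_eq, ← sub_div, abs_div, Nat.abs_cast, Nat.factorial_succ,
    div_le_iff₀ (by positivity)]
  refine (abs_pow_sub_pow_le _ _ _).trans ?_
  have h1 : max |max x 0| |max y 0| ≤ b := by
    rw [abs_of_nonneg (le_max_right _ _), abs_of_nonneg (le_max_right _ _)]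
    exact max_le (max_le hx hb) (max_le hy hb)
  have h2 : |max x 0 - max y 0| ≤ |x - y| := abs_max_sub_max_le_abs _ _ _
  calc _ ≤ |x - y| * (n + 1 : ℕ) * b ^ (n + 1 - 1) := by gcongr
    _ = _ := by
      push_cast
      field_simp

section RepeatedIntegral

variable {E : Type*} [NormedAddCommGroup E] [NormedSpace ℝ E]

/-- The `(n + 1)`-fold repeated integral of a function supported in a right half line, in Cauchy's
form as a single integral. -/
noncomputable def cauchyInt (n : ℕ) (h : ℝ → E) (x : ℝ) : E := ∫ t, truncPow n (x - t) • h t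

theorem integrable_truncPow_smul (n : ℕ) {h : ℝ → E} (hh : Integrable h) {A : ℝ}
    (hA : ∀ t ≤ A, h t = 0) (x : ℝ) : Integrable fun t => truncPow n (x - t) • h t := by
  refine (hh.norm.const_mul (truncPow n (x - A))).mono' ?_ (Eventually.of_forall fun t => ?_)
  · exact ((measurable_truncPow n).comp (by fun_prop)).aestronglyMeasurable.smul hh.1
  · rw [norm_smul, Real.norm_of_nonneg (truncPow_nonneg _ _)]
    rcases le_or_gt t A with ht | ht
    · simp [hA t ht]
    · exact mul_le_mul_of_nonneg_right (monotone_truncPow n (by linarith)) (norm_nonneg _)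

theorem cauchyInt_zero {h : ℝ → E} {A : ℝ} (hA : ∀ t ≤ A, h t = 0) (x : ℝ) :
    cauchyInt 0 h x = ∫ t in A..x, h t := by
  have h1 : ∀ t, truncPow 0 (x - t) • h t = (Ioo A x).indicator h t := by
    intro t
    by_cases ht : t ∈ Ioo A x
    · rw [indicator_of_mem ht, truncPow_of_pos _ (sub_pos.2 ht.2)]; simp
    · rw [indicator_of_notMem ht]
      rcases le_or_gt t A with h1 | h1
      · rw [hA t h1, smul_zero]
      · rw [truncPow_of_nonpos _ (sub_nonpos.2 (not_lt.1 fun h2 => ht ⟨h1, h2⟩)), zero_smul]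
  rw [cauchyInt]
  simp_rw [h1]
  rw [integral_indicator measurableSet_Ioo]
  rcases le_total A x with hx | hx
  · rw [intervalIntegral.integral_of_le hx, integral_Ioc_eq_integral_Ioo]
  · rw [Ioo_eq_empty (not_lt.2 hx), intervalIntegral.integral_of_ge hx,
      setIntegral_eq_zero_of_forall_eq_zero (t := Ioc x A) fun t ht => hA t ht.2]
    simp

theorem hasDerivAt_cauchyInt_succ (n : ℕ) {h : ℝ → E} (hh : Integrable h)
    {A : ℝ} (hA : ∀ t ≤ A, h t = 0) (x : ℝ) :
    HasDerivAt (cauchyInt (n + 1) h) (cauchyInt n h x) x := by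
  have hb : 0 ≤ |x| + 1 + |A| := by positivity
  refine (hasDerivAt_integral_of_dominated_loc_of_lip (s := Metric.ball x 1)
    (F := fun x t => truncPow (n + 1) (x - t) • h t) (F' := fun t => truncPow n (x - t) • h t)
    (bound := fun t => (|x| + 1 + |A|) ^ n / n.factorial * ‖h t‖)
    (Metric.ball_mem_nhds _ one_pos)
    (Eventually.of_forall fun y => (integrable_truncPow_smul _ hh hA y).1)
    (integrable_truncPow_smul _ hh hA x) (integrable_truncPow_smul _ hh hA x).1
    (Eventually.of_forall fun t => ?_) (hh.norm.const_mul _) ?_).2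
  · refine LipschitzOnWith.of_dist_le_mul fun y hy z hz => ?_
    rw [Metric.mem_ball, Real.dist_eq] at hy hz
    have hpos : 0 ≤ (|x| + 1 + |A|) ^ n / n.factorial * ‖h t‖ := by positivity
    rw [dist_eq_norm, ← sub_smul, norm_smul, Real.dist_eq, Real.coe_nnabs, abs_of_nonneg hpos,
      Real.norm_eq_abs]
    rcases le_or_gt t A with ht | ht
    · simp [hA t ht]
    · have := abs_truncPow_succ_sub_le n hb (x := y - t) (y := z - t)
        (by linarith [(abs_lt.1 hy).2, le_abs_self x, neg_abs_le A])
        (by linarith [(abs_lt.1 hz).2, le_abs_self x, neg_abs_le A])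
      rw [sub_sub_sub_cancel_right] at this
      calc _ ≤ _ := mul_le_mul_of_nonneg_right this (norm_nonneg (h t))
        _ = _ := by ring
  · have hne : ∀ᵐ t : ℝ, t ≠ x := by simp [ae_iff, measure_singleton]
    filter_upwards [hne] with t ht
    exact ((hasDerivAt_truncPow_succ n (sub_ne_zero.2 ht.symm)).comp_sub_const x t).smul_const _

theorem contDiff_cauchyInt [CompleteSpace E] (n : ℕ) {h : ℝ → E} (hh : Integrable h)
    {A : ℝ} (hA : ∀ t ≤ A, h t = 0) : ContDiff ℝ (n : ℕ) (cauchyInt n h) := by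
  induction n with
  | zero =>
    rw [Nat.cast_zero, contDiff_zero, show cauchyInt 0 h = _ from funext (cauchyInt_zero hA)]
    exact intervalIntegral.continuous_primitive (fun a b => hh.intervalIntegrable) A
  | succ n ih =>
    have hd := hasDerivAt_cauchyInt_succ n hh hA
    rw [Nat.cast_succ, contDiff_succ_iff_deriv]
    refine ⟨fun x => (hd x).differentiableAt, by simp, ?_⟩
    rwa [show deriv (cauchyInt (n + 1) h) = cauchyInt n h from funext fun x => (hd x).deriv]

theorem iteratedDeriv_cauchyInt (n : ℕ) {h : ℝ → E} (hh : Integrable h)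
    {A : ℝ} (hA : ∀ t ≤ A, h t = 0) : iteratedDeriv n (cauchyInt n h) = cauchyInt 0 h := by
  induction n with
  | zero => simp
  | succ n ih =>
    rw [iteratedDeriv_succ', show deriv (cauchyInt (n + 1) h) = cauchyInt n h from
      funext fun x => (hasDerivAt_cauchyInt_succ n hh hA x).deriv, ih]

end RepeatedIntegral

theorem IterDifferentiableAt.congr_of_eventuallyEq {n : ℕ} {f g : ℝ → ℂ} {x : ℝ}
    (hf : IterDifferentiableAt n f x) (h : g =ᶠ[𝓝 x] f) : IterDifferentiableAt n g x := by
  cases n with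
  | zero => trivial
  | succ n =>
    exact ⟨hf.1.congr_of_eventuallyEq h, hf.2.congr_of_eventuallyEq (h.iteratedDeriv n)⟩

/-- At a point where the first primitive of `h` has derivative `v`, the `(n + 1)`-fold repeated
integral of `h` has the classical `(n + 1)`-st derivative `v`. -/
theorem iterDifferentiableAt_cauchyInt (n : ℕ) {h : ℝ → ℂ} (hh : Integrable h) {A : ℝ}
    (hA : ∀ t ≤ A, h t = 0) {x : ℝ} {v : ℂ} (hv : HasDerivAt (fun x => ∫ t in A..x, h t) v x) :
    IterDifferentiableAt (n + 1) (cauchyInt n h) x ∧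
      iteratedDeriv (n + 1) (cauchyInt n h) x = v := by
  rw [← show cauchyInt 0 h = _ from funext (cauchyInt_zero hA)] at hv
  refine ⟨⟨(contDiff_cauchyInt n hh hA).contDiffAt, ?_⟩, ?_⟩
  · rw [iteratedDeriv_cauchyInt n hh hA]; exact hv.differentiableAt
  · rw [iteratedDeriv_succ, iteratedDeriv_cauchyInt n hh hA, hv.deriv]

/-! ### Lebesgue points common to a one-parameter family -/

/-- If the family `H y` is controlled by the increments of a family `N y` that depends continuously
on `y`, then almost every `X` is a point of differentiability of the primitives of all `H y` at
once: it suffices to treat rational `y`, and to interpolate. -/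
theorem ae_forall_hasDerivAt_integral (H : ℝ → ℝ → ℂ) (N : ℝ → ℝ → ℝ) (hH : ∀ y, Integrable (H y))
    (hN : ∀ y, Integrable (N y))
    (hle : ∀ᵐ t, ∀ y q, y ≤ q → ‖H q t - H y t‖ ≤ N q t - N y t)
    (hcont : ∀ᵐ t, Continuous fun y => N y t) (A : ℝ) :
    ∀ᵐ X, ∀ y, HasDerivAt (fun x => ∫ t in A..x, H y t) (H y X) X := by
  have hH1 : ∀ᵐ X, ∀ q : ℚ, HasDerivAt (fun x => ∫ t in A..x, H q t) (H q X) X :=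
    ae_all_iff.2 fun q => (LocallyIntegrable.ae_hasDerivAt_integral
      (hH q).locallyIntegrable).mono fun X h => h A
  have hN1 : ∀ᵐ X, ∀ q : ℚ, HasDerivAt (fun x => ∫ t in A..x, N q t) (N q X) X :=
    ae_all_iff.2 fun q => (LocallyIntegrable.ae_hasDerivAt_integral
      (hN q).locallyIntegrable).mono fun X h => h A
  filter_upwards [hH1, hN1, hle, hcont] with X hHX hNX hleX hcX y
  rw [hasDerivAt_iff_isLittleO, Asymptotics.isLittleO_iff]
  intro ε hε
  -- Rational `q < y < q'` with `N q' X - N q X ≤ ε / 4`; then `H q` is a good substitute for `H y`,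
  -- both at `X` and in the mean over short intervals at `X`.
  have hnear : ∀ᶠ y' in 𝓝 y, |N y' X - N y X| < ε / 8 :=
    Metric.continuousAt_iff'.1 hcX.continuousAt (ε / 8) (by positivity)
  obtain ⟨δ, hδ, hball⟩ := Metric.eventually_nhds_iff.1 hnear
  obtain ⟨q, hq1, hq2⟩ := exists_rat_btwn (show y - δ < y by linarith)
  obtain ⟨q', hq1', hq2'⟩ := exists_rat_btwn (show y < y + δ by linarith)
  have hNq := hball (y := (q : ℝ)) (by rw [Real.dist_eq, abs_lt]; constructor <;> linarith)
  have hNq' := hball (y := (q' : ℝ)) (by rw [Real.dist_eq, abs_lt]; constructor <;> linarith)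
  have hgap : N q' X - N q X ≤ ε / 4 := by
    linarith [(abs_lt.1 hNq).1, (abs_lt.1 hNq').2]
  have hmid : ∀ t, (∀ y q, y ≤ q → ‖H q t - H y t‖ ≤ N q t - N y t) →
      ‖H y t - H q t‖ ≤ N q' t - N q t := fun t ht => by
    have h1 := ht q y hq2.le
    have h2 := (norm_nonneg _).trans (ht y q' hq1'.le)
    linarith
  have hI : ∀ y a b, IntervalIntegrable (H y) volume a b := fun y a b => (hH y).intervalIntegrable
  have hJ : ∀ y a b, IntervalIntegrable (N y) volume a b := fun y a b => (hN y).intervalIntegrable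
  have e1 := (Asymptotics.isLittleO_iff.1 (hasDerivAt_iff_isLittleO.1 (hHX q)))
    (show 0 < ε / 4 by positivity)
  have e2 := (Asymptotics.isLittleO_iff.1 (hasDerivAt_iff_isLittleO.1 ((hNX q').sub (hNX q))))
    (show 0 < ε / 4 by positivity)
  filter_upwards [e1, e2] with x h1 h2
  have h3 : ‖∫ t in X..x, (H y t - H q t)‖ ≤ |∫ t in X..x, (N q' t - N q t)| :=
    intervalIntegral.norm_integral_le_abs_of_norm_le
      (ae_restrict_of_ae (hle.mono hmid)) ((hJ _ _ _).sub (hJ _ _ _))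
  rw [intervalIntegral.integral_sub (hI _ _ _) (hI _ _ _),
    intervalIntegral.integral_sub (hJ _ _ _) (hJ _ _ _),
    ← intervalIntegral.integral_interval_sub_left (hI y A x) (hI y A X),
    ← intervalIntegral.integral_interval_sub_left (hI q A x) (hI q A X),
    ← intervalIntegral.integral_interval_sub_left (hJ q' A x) (hJ q' A X),
    ← intervalIntegral.integral_interval_sub_left (hJ q A x) (hJ q A X)] at h3
  have h4 := hmid X hleX
  simp only [Pi.sub_apply, Real.norm_eq_abs, smul_eq_mul] at h1 h2 ⊢
  have h5 : |(∫ t in A..x, N q' t) - (∫ t in A..X, N q' t) -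
      ((∫ t in A..x, N q t) - ∫ t in A..X, N q t)| ≤ ε / 2 * |x - X| := by
    have h6 : |(x - X) * (N q' X - N q X)| ≤ ε / 4 * |x - X| := by
      rw [abs_mul, abs_of_nonneg ((norm_nonneg _).trans h4), mul_comm]
      gcongr
    have h7 := abs_sub_abs_le_abs_sub ((∫ t in A..x, N q' t) - (∫ t in A..X, N q' t) -
      ((∫ t in A..x, N q t) - ∫ t in A..X, N q t)) ((x - X) * (N q' X - N q X))
    have h8 : (∫ t in A..x, N q' t) - (∫ t in A..X, N q' t) -
      ((∫ t in A..x, N q t) - ∫ t in A..X, N q t) - (x - X) * (N q' X - N q X) =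
      (∫ t in A..x, N q' t) - (∫ t in A..x, N q t) - ((∫ t in A..X, N q' t) - ∫ t in A..X, N q t)
        - (x - X) * (N q' X - N q X) := by ring
    rw [h8] at h7
    linarith
  have h9 : ‖(x - X) • (H y X - H q X)‖ ≤ ε / 4 * |x - X| := by
    rw [norm_smul, Real.norm_eq_abs, mul_comm]
    gcongr
    linarith
  have h10 : (∫ t in A..x, H y t) - (∫ t in A..X, H y t) - (x - X) • H y X =
      ((∫ t in A..x, H q t) - (∫ t in A..X, H q t) - (x - X) • H q X) +
      (((∫ t in A..x, H y t) - (∫ t in A..X, H y t)) -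
        ((∫ t in A..x, H q t) - (∫ t in A..X, H q t))) - (x - X) • (H y X - H q X) := by
    rw [smul_sub]; abel
  rw [h10]
  refine (norm_sub_le _ _).trans ((add_le_add_left (norm_add_le _ _) _).trans ?_)
  linarith

/-- Almost every point `(X, Y)` is a point of differentiability of the primitive in the second
variable. By Fubini's theorem this is the one-dimensional differentiation theorem, as soon as the
set of good points is known to be measurable; for this, differentiability is tested on rational
increments. -/
theorem ae_hasDerivAt_integral_snd {φ : ℝ × ℝ → ℂ} (hm : StronglyMeasurable φ) (hφ : Integrable φ)
    {C : ℝ} (hC : ∀ t, ∀ w ≤ C, φ (t, w) = 0) :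
    ∀ᵐ p : ℝ × ℝ, HasDerivAt (fun y => ∫ w in C..y, φ (p.1, w)) (φ p) p.2 := by
  have hsec : ∀ᵐ t, Integrable fun w => φ (t, w) := by
    rw [Measure.volume_eq_prod] at hφ; exact hφ.prod_right_ae
  let F : ℝ × ℝ → ℂ := fun p => ∫ w, truncPow 0 (p.2 - w) • φ (p.1, w)
  have hFm : Measurable F := by
    refine StronglyMeasurable.measurable ?_
    refine StronglyMeasurable.integral_prod_right
      (f := fun (p : ℝ × ℝ) w => truncPow 0 (p.2 - w) • φ (p.1, w)) ?_
    have h1 : Measurable fun x : (ℝ × ℝ) × ℝ => truncPow 0 (x.1.2 - x.2) :=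
      (measurable_truncPow 0).comp (by fun_prop)
    have h2 : Measurable fun x : (ℝ × ℝ) × ℝ => φ (x.1.1, x.2) :=
      hm.measurable.comp (by fun_prop)
    exact (h1.smul h2).stronglyMeasurable
  let good : ℕ → ℕ → ℚ → ℝ × ℝ → Prop := fun k j h p => |(h : ℝ)| < 1 / (j + 1) →
    ‖F (p.1, p.2 + h) - F p - (h : ℝ) • φ p‖ ≤ 1 / (k + 1) * |(h : ℝ)|
  let S : Set (ℝ × ℝ) := {p | ∀ k, ∃ j, ∀ h, good k j h p}
  have hS : MeasurableSet S := by
    have h1 : S = ⋂ k, ⋃ j, ⋂ h, {p | good k j h p} := by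
      ext p; simp [S]
    rw [h1]
    refine MeasurableSet.iInter fun k => MeasurableSet.iUnion fun j => MeasurableSet.iInter fun h =>
      ?_
    by_cases hh : |(h : ℝ)| < 1 / (j + 1)
    · simp only [good, hh, true_imp_iff]
      refine measurableSet_le (Measurable.norm ?_) measurable_const
      exact ((hFm.comp (by fun_prop)).sub hFm).sub (hm.measurable.const_smul (h : ℝ))
    · simp only [good, hh, false_imp_iff, Set.ofPred_true, MeasurableSet.univ]
  have hequiv : ∀ t, (Integrable fun w => φ (t, w)) → ∀ y, (t, y) ∈ S ↔
      HasDerivAt (fun y => ∫ w in C..y, φ (t, w)) (φ (t, y)) y := by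
    intro t ht y
    have hF0 : ∀ y, F (t, y) = ∫ w in C..y, φ (t, w) := cauchyInt_zero (hC t)
    have hcont : Continuous fun y => F (t, y) := by
      simp_rw [hF0]
      exact intervalIntegral.continuous_primitive (fun a b => ht.intervalIntegrable) C
    rw [hasDerivAt_iff_isLittleO_nhds_zero, Asymptotics.isLittleO_iff]
    simp_rw [← hF0]
    constructor
    · intro hS c hc
      obtain ⟨k, hk⟩ := exists_nat_one_div_lt hc
      obtain ⟨j, hj⟩ := hS k
      have hball : Metric.ball (0 : ℝ) (1 / (j + 1)) ∈ 𝓝 (0 : ℝ) :=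
        Metric.ball_mem_nhds _ (by positivity)
      filter_upwards [hball] with h hh
      have hcl : h ∈ closure (Metric.ball (0 : ℝ) (1 / (j + 1)) ∩ range ((↑) : ℚ → ℝ)) :=
        Dense.open_subset_closure_inter Rat.denseRange_cast Metric.isOpen_ball hh
      have hclosed : IsClosed {h : ℝ | ‖F (t, y + h) - F (t, y) - h • φ (t, y)‖ ≤
          1 / (k + 1) * |h|} := by
        refine isClosed_le ?_ (by fun_prop)
        exact (((hcont.comp (by fun_prop)).sub continuous_const).sub (by fun_prop)).norm
      have hmem : h ∈ {h : ℝ | ‖F (t, y + h) - F (t, y) - h • φ (t, y)‖ ≤ 1 / (k + 1) * |h|} := by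
        refine closure_minimal ?_ hclosed hcl
        rintro _ ⟨h1, q, rfl⟩
        refine hj q ?_
        rwa [mem_ball_zero_iff, Real.norm_eq_abs] at h1
      refine le_trans hmem ?_
      rw [Real.norm_eq_abs]
      gcongr
    · intro hd k
      have h1 := hd (show (0 : ℝ) < 1 / (k + 1) by positivity)
      obtain ⟨δ, hδ, hball⟩ := Metric.eventually_nhds_iff.1 h1
      obtain ⟨j, hj⟩ := exists_nat_one_div_lt hδ
      refine ⟨j, fun q hq => ?_⟩
      exact hball (by rw [Real.dist_eq, sub_zero]; exact hq.trans hj)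
  have hae : ∀ᵐ p : ℝ × ℝ, p ∈ S := by
    rw [Measure.volume_eq_prod, Measure.ae_prod_mem_iff_ae_ae_mem hS]
    filter_upwards [hsec] with t ht
    filter_upwards [LocallyIntegrable.ae_hasDerivAt_integral ht.locallyIntegrable] with y hy
    exact (hequiv t ht y).2 (hy C)
  have hsec' : ∀ᵐ p : ℝ × ℝ, Integrable fun w => φ (p.1, w) := by
    rw [Measure.volume_eq_prod]; exact Measure.quasiMeasurePreserving_fst.ae hsec
  filter_upwards [hae, hsec'] with p h1 h2
  exact (hequiv p.1 h2 p.2).1 h1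

theorem integrable_truncPow_smul_snd {E : Type*} [NormedAddCommGroup E] [NormedSpace ℝ E] (m : ℕ)
    {φ : ℝ × ℝ → E} (hφ : Integrable φ) {C : ℝ} (hC : ∀ t, ∀ w ≤ C, φ (t, w) = 0) (y : ℝ) :
    Integrable fun z : ℝ × ℝ => truncPow m (y - z.2) • φ z := by
  refine (hφ.norm.const_mul (truncPow m (y - C))).mono' ?_ (Eventually.of_forall fun z => ?_)
  · exact ((measurable_truncPow m).comp (by fun_prop)).aestronglyMeasurable.smul hφ.1
  · rw [norm_smul, Real.norm_of_nonneg (truncPow_nonneg _ _)]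
    rcases le_or_gt z.2 C with hz | hz
    · rw [show φ z = 0 from hC z.1 z.2 hz]; simp
    · exact mul_le_mul_of_nonneg_right (monotone_truncPow m (by linarith)) (norm_nonneg _)

theorem integrable_cauchyInt_snd {E : Type*} [NormedAddCommGroup E] [NormedSpace ℝ E] (m : ℕ)
    {φ : ℝ × ℝ → E} (hφ : Integrable φ) {C : ℝ} (hC : ∀ t, ∀ w ≤ C, φ (t, w) = 0) (y : ℝ) :
    Integrable fun t => cauchyInt m (fun w => φ (t, w)) y := by
  have h := integrable_truncPow_smul_snd m hφ hC y
  rw [Measure.volume_eq_prod] at h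
  exact h.integral_prod_left

/-- The mixed repeated integral of order `n + 1` in the first and `m + 1` in the second variable can
be undone by classical derivatives at almost every point. -/
theorem ae_iterDifferentiableAt_cauchyInt₂ (n m : ℕ) {φ : ℝ × ℝ → ℂ} (hm : StronglyMeasurable φ)
    (hφ : Integrable φ) {A C : ℝ} (hA : ∀ t ≤ A, ∀ w, φ (t, w) = 0)
    (hC : ∀ t, ∀ w ≤ C, φ (t, w) = 0) :
    ∀ᵐ p : ℝ × ℝ, (∀ y,
      IterDifferentiableAt (n + 1)
        (cauchyInt n fun t => cauchyInt m (fun w => φ (t, w)) y) p.1 ∧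
      iteratedDeriv (n + 1) (cauchyInt n fun t => cauchyInt m (fun w => φ (t, w)) y) p.1 =
        cauchyInt m (fun w => φ (p.1, w)) y) ∧
      IterDifferentiableAt (m + 1) (cauchyInt m fun w => φ (p.1, w)) p.2 ∧
      iteratedDeriv (m + 1) (cauchyInt m fun w => φ (p.1, w)) p.2 = φ p := by
  have hsec : ∀ᵐ t, Integrable fun w => φ (t, w) := by
    rw [Measure.volume_eq_prod] at hφ; exact hφ.prod_right_ae
  let H : ℝ → ℝ → ℂ := fun y t => cauchyInt m (fun w => φ (t, w)) y
  let N : ℝ → ℝ → ℝ := fun y t => cauchyInt m (fun w => ‖φ (t, w)‖) y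
  have hCn : ∀ t, ∀ w ≤ C, ‖φ (t, w)‖ = 0 := fun t w hw => by rw [hC t w hw, norm_zero]
  have hle : ∀ᵐ t, ∀ y q, y ≤ q → ‖H q t - H y t‖ ≤ N q t - N y t := by
    filter_upwards [hsec] with t ht y q hyq
    have i1 := fun x => integrable_truncPow_smul m ht (hC t) x
    have i2 := fun x => integrable_truncPow_smul m ht.norm (hCn t) x
    simp only [H, N, cauchyInt]
    rw [← integral_sub (i1 q) (i1 y), ← integral_sub (i2 q) (i2 y)]
    refine norm_integral_le_of_norm_le ((i2 q).sub (i2 y)) (Eventually.of_forall fun w => ?_)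
    rw [← sub_smul, ← sub_smul, norm_smul, Real.norm_of_nonneg, smul_eq_mul]
    exact sub_nonneg.2 (monotone_truncPow m (by linarith))
  have hcont : ∀ᵐ t, Continuous fun y => N y t := by
    filter_upwards [hsec] with t ht
    exact (contDiff_cauchyInt m ht.norm (hCn t)).continuous
  have hHi : ∀ y, Integrable (H y) := fun y => integrable_cauchyInt_snd m hφ hC y
  have hNi : ∀ y, Integrable (N y) := fun y => integrable_cauchyInt_snd m hφ.norm hCn y
  have hHA : ∀ y, ∀ t ≤ A, H y t = 0 := fun y t ht => by simp [H, cauchyInt, hA t ht]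
  have h1 := Measure.quasiMeasurePreserving_fst (μ := (volume : Measure ℝ))
    (ν := (volume : Measure ℝ)) |>.ae (ae_forall_hasDerivAt_integral H N hHi hNi hle hcont A)
  have h2 := Measure.quasiMeasurePreserving_fst (μ := (volume : Measure ℝ))
    (ν := (volume : Measure ℝ)) |>.ae hsec
  rw [← Measure.volume_eq_prod] at h1 h2
  filter_upwards [h1, h2, ae_hasDerivAt_integral_snd hm hφ hC] with p hp1 hp2 hp3
  exact ⟨fun y => iterDifferentiableAt_cauchyInt n (hHi y) (hHA y) (hp1 y),
    iterDifferentiableAt_cauchyInt m hp2 (hC p.1) hp3⟩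

/-! ### The fractional derivative of the composed operators -/

theorem exists_integral_norm_powKer_mul_powKer {a b : ℂ} (ha : 0 < a.re) (hb : 0 < b.re) :
    ∃ K : ℝ, 0 ≤ K ∧ ∀ x : ℝ, 0 < x →
      ∫ t in Ioo 0 x, ‖powKer a t * powKer b (x - t)‖ = K * x ^ (a.re + b.re - 1) := by
  -- On the positive axis, `‖powKer a t‖` is a constant multiple of the kernel of order `a.re`.
  have hG : ∀ c : ℂ, 0 < c.re → Complex.Gamma (c.re : ℂ) ≠ 0 := fun c hc =>
    Complex.Gamma_ne_zero_of_re_pos (by simpa using hc)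
  let c : ℂ → ℂ := fun a => Complex.Gamma (a.re : ℂ) / ‖Complex.Gamma a‖
  refine ⟨‖c a * c b‖ / ‖Complex.Gamma ((a.re : ℂ) + b.re)‖, by positivity, fun x hx => ?_⟩
  have hnorm : ∀ a : ℂ, 0 < a.re → ∀ t : ℝ, 0 < t →
      ((‖powKer a t‖ : ℝ) : ℂ) = c a * powKer a.re t := by
    intro a ha t ht
    have h1 : (t : ℂ) ^ ((a.re : ℂ) - 1) = ((t ^ (a.re - 1) : ℝ) : ℂ) := by
      rw [Complex.ofReal_cpow ht.le]; push_cast; rfl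
    have h2 := hG a ha
    rw [norm_powKer _ ht, powKer, h1]
    simp only [c]
    push_cast
    field_simp
  have hC : ((∫ t in Ioo 0 x, ‖powKer a t * powKer b (x - t)‖ : ℝ) : ℂ) =
      c a * c b * powKer ((a.re : ℂ) + b.re) x := by
    rw [← integral_powKer_mul_powKer (by simpa using ha) (by simpa using hb) hx,
      ← integral_const_mul, ← integral_complex_ofReal]
    refine setIntegral_congr_fun measurableSet_Ioo fun t ht => ?_
    simp only [norm_mul]
    rw [Complex.ofReal_mul, hnorm a ha t ht.1, hnorm b hb _ (sub_pos.2 ht.2)]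
    ring
  have h3 := congrArg norm hC
  rw [Complex.norm_real, Real.norm_of_nonneg (integral_nonneg fun _ => norm_nonneg _), norm_mul,
    norm_powKer _ hx] at h3
  rw [h3, Complex.add_re, Complex.ofReal_re, Complex.ofReal_re]
  ring

/-- The convolution of the absolute values of two power kernels is bounded when the total order is
at least one in each variable. -/
theorem exists_integral_norm_powKer₂_mul_powKer₂_le {a b c d : ℂ} (ha : 0 < a.re) (hb : 0 < b.re)
    (hc : 0 < c.re) (hd : 0 < d.re) (hac : 1 ≤ a.re + c.re) (hbd : 1 ≤ b.re + d.re) (L M : ℝ) :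
    ∃ K : ℝ, ∀ z ∈ openBox 0 L 0 M,
      ∫ q in openBox 0 z.1 0 z.2, ‖powKer₂ a b q * powKer₂ c d (z - q)‖ ≤ K := by
  obtain ⟨K₁, hK₁, h₁⟩ := exists_integral_norm_powKer_mul_powKer ha hc
  obtain ⟨K₂, hK₂, h₂⟩ := exists_integral_norm_powKer_mul_powKer hb hd
  refine ⟨K₁ * L ^ (a.re + c.re - 1) * (K₂ * M ^ (b.re + d.re - 1)), fun z hz => ?_⟩
  have h3 : ∀ q, ‖powKer₂ a b q * powKer₂ c d (z - q)‖ =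
      ‖powKer a q.1 * powKer c (z.1 - q.1)‖ * ‖powKer b q.2 * powKer d (z.2 - q.2)‖ := fun q => by
    rw [← norm_mul, powKer₂, powKer₂, Prod.fst_sub, Prod.snd_sub]
    congr 1; ring
  simp_rw [h3]
  rw [Measure.volume_eq_prod, setIntegral_prod_mul
    (fun t => ‖powKer a t * powKer c (z.1 - t)‖) (fun w => ‖powKer b w * powKer d (z.2 - w)‖),
    h₁ _ hz.1.1, h₂ _ hz.2.1]
  have h4 := Real.rpow_le_rpow hz.1.1.le hz.1.2.le (sub_nonneg.2 hac)
  have h5 := Real.rpow_le_rpow hz.2.1.le hz.2.2.le (sub_nonneg.2 hbd)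
  have h6 := Real.rpow_nonneg hz.2.1.le (b.re + d.re - 1)
  have h7 := Real.rpow_nonneg (hz.1.1.trans hz.1.2).le (a.re + c.re - 1)
  gcongr

theorem rlIntegral₂_eq (A C : ℝ) (μ ζ : ℂ) (g : ℝ × ℝ → ℂ) (p : ℝ × ℝ) :
    rlIntegral₂ A C μ ζ g p =
      ∫ w in C..p.2, ∫ t in A..p.1, powKer₂ μ ζ (p.1 - t, p.2 - w) * g (t, w) := by
  rw [rlIntegral₂, ← intervalIntegral.integral_const_mul]
  congr 1; ext w
  rw [← intervalIntegral.integral_const_mul]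
  congr 1; ext t
  rw [powKer₂, powKer, powKer]
  ring

theorem powKer_natCast_add_one (n : ℕ) {x : ℝ} (hx : 0 < x) :
    powKer (n + 1) x = (truncPow n x : ℂ) := by
  rw [powKer, truncPow_of_pos n hx, add_sub_cancel_right, Complex.cpow_natCast,
    Complex.Gamma_nat_eq_factorial]
  push_cast
  rfl

theorem boxConv_powKer₂_natCast {A B C D : ℝ} (n m : ℕ) {φ : ℝ × ℝ → ℂ}
    (hφ : IntegrableOn φ (openBox A B C D)) {p : ℝ × ℝ} (hp : p ∈ openBox A B C D) :
    boxConv (openBox A B C D) (openBox 0 (B - A) 0 (D - C)) φ (powKer₂ (n + 1) (m + 1)) p =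
      cauchyInt n (fun t =>
        cauchyInt m (fun w => (openBox A B C D).indicator φ (t, w)) p.2) p.1 := by
  have hint := hφ.integrable_indicator measurableSet_openBox
  have h1 : ∀ q, (openBox A B C D).indicator φ q *
      (openBox 0 (B - A) 0 (D - C)).indicator (powKer₂ (n + 1) (m + 1)) (p - q) =
      truncPow n (p.1 - q.1) • truncPow m (p.2 - q.2) • (openBox A B C D).indicator φ q := by
    intro q
    by_cases hq : q ∈ openBox A B C D
    · by_cases hz : p - q ∈ openBox 0 (B - A) 0 (D - C)
      · rw [indicator_of_mem hz, powKer₂, powKer_natCast_add_one n hz.1.1,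
          powKer_natCast_add_one m hz.2.1]
        simp only [Complex.real_smul, Prod.fst_sub, Prod.snd_sub]
        ring
      · rw [indicator_of_notMem hz, mul_zero]
        rcases le_or_gt (p.1 - q.1) 0 with h2 | h2
        · rw [truncPow_of_nonpos n h2, zero_smul]
        · rw [truncPow_of_nonpos m (x := p.2 - q.2), zero_smul, smul_zero]
          by_contra h3
          refine hz ⟨⟨h2, ?_⟩, ⟨not_le.1 h3, ?_⟩⟩
          · simp only [Prod.fst_sub]; linarith [hp.1.2, hq.1.1]
          · simp only [Prod.snd_sub]; linarith [hp.2.2, hq.2.1]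
    · simp [indicator_of_notMem hq]
  have hC : ∀ t, ∀ w ≤ C, (openBox A B C D).indicator φ (t, w) = 0 := fun t w hw =>
    indicator_of_notMem (fun h => not_lt.2 hw h.2.1) _
  have h2 : Integrable fun q : ℝ × ℝ => truncPow n (p.1 - q.1) • truncPow m (p.2 - q.2) •
      (openBox A B C D).indicator φ q := by
    have h3 := integrable_truncPow_smul_snd m hint hC p.2
    refine (h3.norm.const_mul (truncPow n (p.1 - A))).mono' ?_ (Eventually.of_forall fun q => ?_)
    · exact ((measurable_truncPow n).comp (by fun_prop)).aestronglyMeasurable.smul h3.1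
    · rw [norm_smul, Real.norm_of_nonneg (truncPow_nonneg _ _)]
      by_cases hq : q ∈ openBox A B C D
      · exact mul_le_mul_of_nonneg_right (monotone_truncPow n (by linarith [hq.1.1]))
          (norm_nonneg _)
      · simp [indicator_of_notMem hq]
  rw [boxConv_apply]
  simp_rw [h1]
  rw [Measure.volume_eq_prod] at h2 ⊢
  rw [integral_prod _ h2, cauchyInt]
  refine integral_congr_ae (Eventually.of_forall fun t => ?_)
  simp only [cauchyInt, integral_smul]

theorem hkIntegral_eq (A C : ℝ) (κ ρ Υ ν₁ ν₂ γ₁ γ₂ : ℂ) (g : ℝ × ℝ → ℂ) (p : ℝ × ℝ) :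
    hkIntegral A C κ ρ Υ ν₁ ν₂ γ₁ γ₂ ((γ₁ + 1) / 2) γ₂ g p =
      ∫ w in C..p.2, ∫ t in A..p.1,
        hkKernel κ ρ Υ ν₁ ν₂ γ₁ γ₂ (p.1 - t, p.2 - w) * g (t, w) := rfl

/-- `𝕀` acts as the convolution with its kernel, almost everywhere on the rectangle. -/
theorem hkIntegral_ae_eq_boxConv {A B C D : ℝ} (hAB : A < B) (hCD : C < D) {κ ρ Υ : ℂ}
    (hκ : 0 < κ.re) (hρ : 0 < ρ.re) (hΥ : 0 < Υ.re) (ν₁ ν₂ γ₁ γ₂ : ℂ) {g : ℝ × ℝ → ℂ}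
    (hg : IntegrableOn g (openBox A B C D)) :
    hkIntegral A C κ ρ Υ ν₁ ν₂ γ₁ γ₂ ((γ₁ + 1) / 2) γ₂ g =ᵐ[volume.restrict (openBox A B C D)]
      boxConv (openBox A B C D) (openBox 0 (B - A) 0 (D - C)) g (hkKernel κ ρ Υ ν₁ ν₂ γ₁ γ₂) := by
  have h := ae_intervalIntegral_eq_boxConv hg
    (integrableOn_hkKernel hκ hρ hΥ ν₁ ν₂ γ₁ γ₂ (sub_pos.2 hAB) (sub_pos.2 hCD))
  filter_upwards [h] with p hp
  rw [hkIntegral_eq]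
  exact hp

/-- If `g` is almost everywhere the mixed Riemann-Liouville integral of `ψ` of order `(α, β)`, then
its mixed Riemann-Liouville integral of the complementary order is, at every point, the repeated
integral of integer order of `ψ`. -/
theorem rlIntegral₂_eq_cauchyInt {A B C D : ℝ} (hAB : A < B) (hCD : C < D) {α β : ℂ}
    (hα : 0 < α.re) (hβ : 0 < β.re) {ψ g : ℝ × ℝ → ℂ} (hψ : IntegrableOn ψ (openBox A B C D))
    (hg : g =ᵐ[volume.restrict (openBox A B C D)]
      boxConv (openBox A B C D) (openBox 0 (B - A) 0 (D - C)) ψ (powKer₂ α β))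
    {p : ℝ × ℝ} (hp : p ∈ openBox A B C D) :
    rlIntegral₂ A C (rlOrder α - α) (rlOrder β - β) g p =
      cauchyInt ⌊α.re⌋₊ (fun t =>
        cauchyInt ⌊β.re⌋₊ (fun w => (openBox A B C D).indicator ψ (t, w)) p.2) p.1 := by
  have hre : ∀ α : ℂ, ((rlOrder α : ℂ) - α).re = ⌊α.re⌋₊ + 1 - α.re := fun α => by
    simp [rlOrder]
  have hpos : ∀ α : ℂ, 0 < ((rlOrder α : ℂ) - α).re := fun α => by
    rw [hre]; linarith [Nat.lt_floor_add_one α.re]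
  have hone : ∀ α : ℂ, 1 ≤ α.re + ((rlOrder α : ℂ) - α).re := fun α => by
    rw [hre]; have : (0 : ℝ) ≤ ⌊α.re⌋₊ := by positivity
    linarith
  have hL := sub_pos.2 hAB
  have hM := sub_pos.2 hCD
  have hadd : ∀ α : ℂ, α + ((rlOrder α : ℂ) - α) = (⌊α.re⌋₊ : ℂ) + 1 := fun α => by
    rw [add_sub_cancel, rlOrder]; push_cast; rfl
  obtain ⟨K, hK⟩ := exists_integral_norm_powKer₂_mul_powKer₂_le hα hβ (hpos α) (hpos β) (hone α)
    (hone β) (B - A) (D - C)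
  obtain ⟨hi, heq⟩ := boxConv_boxConv_of_bounded hψ
    (integrableOn_powKer₂ (z := (B - A, D - C)) hα hβ hL hM)
    (integrableOn_powKer₂ (z := (B - A, D - C)) (hpos α) (hpos β) hL hM)
    (J := powKer₂ ((⌊α.re⌋₊ : ℂ) + 1) ((⌊β.re⌋₊ : ℂ) + 1))
    (fun z hz => by
      rw [integral_powKer₂_mul_powKer₂ hα hβ (hpos α) (hpos β) hz.1.1 hz.2.1, hadd, hadd])
    (fun z hz => integrableOn_powKer₂_mul_powKer₂ hα hβ (hpos α) (hpos β) hz.1.1 hz.2.1) hK hp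
  rw [← boxConv_powKer₂_natCast _ _ hψ hp, ← heq, ← boxConv_congr_ae measurableSet_openBox hg,
    rlIntegral₂_eq]
  refine intervalIntegral_eq_boxConv hp (hi.congr ?_)
  filter_upwards [(ae_restrict_iff' measurableSet_openBox).1 hg] with q hq
  by_cases hqR : q ∈ openBox A B C D
  · simp only [indicator_of_mem hqR, hq hqR]
  · simp only [indicator_of_notMem hqR]

theorem mainTheorem4 (A B C D : ℝ) (hAB : A < B) (hCD : C < D)
    (κ ρ σ η Υ ν₁ ν₂ γ₁ γ₂ : ℂ)
    (hκ : 0 < κ.re) (hρ : 0 < ρ.re) (hσ : 0 < σ.re) (hη : 0 < η.re) (hΥ : 0 < Υ.re)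
    (ψ : ℝ × ℝ → ℂ) (hψ : IntegrableOn ψ (Ioo A B ×ˢ Ioo C D)) :
    IntegrableOn (hkIntegral A C κ ρ Υ ν₁ ν₂ γ₁ γ₂ ((γ₁ + 1) / 2) γ₂ ψ)
        (Ioo A B ×ˢ Ioo C D) ∧
    ∀ f : ℝ × ℝ → ℂ,
      f =ᵐ[volume.restrict (Ioo A B ×ˢ Ioo C D)]
        hkIntegral A C κ ρ Υ ν₁ ν₂ γ₁ γ₂ ((γ₁ + 1) / 2) γ₂ ψ →
      ∀ᵐ p ∂(volume.restrict (Ioo A B ×ˢ Ioo C D)),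
        RLDeriv₂ExistsAt A C (κ + σ) (ρ + η)
          (hkIntegral A C σ η Υ ν₁ ν₂ (-γ₁) (-γ₂) ((-γ₁ + 1) / 2) (-γ₂) f) p ∧
        hkDeriv A C κ ρ σ η Υ ν₁ ν₂ γ₁ γ₂ f p = ψ p := by
  have hmR : MeasurableSet (openBox A B C D) := measurableSet_openBox
  have hmQ : MeasurableSet (openBox 0 (B - A) 0 (D - C)) := measurableSet_openBox
  have hL := sub_pos.2 hAB
  have hM := sub_pos.2 hCD
  have hk := integrableOn_hkKernel hκ hρ hΥ ν₁ ν₂ γ₁ γ₂ hL hM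
  have hk' := integrableOn_hkKernel hσ hη hΥ ν₁ ν₂ (-γ₁) (-γ₂) hL hM
  have hI := hkIntegral_ae_eq_boxConv hAB hCD hκ hρ hΥ ν₁ ν₂ γ₁ γ₂ hψ
  have hIint := (integrable_boxConv hmR hmQ hψ hk).integrableOn (s := openBox A B C D)
  refine ⟨hIint.congr hI.symm, fun f hf => ?_⟩
  have hfg := hf.trans hI
  have hfint : IntegrableOn f (openBox A B C D) := hIint.congr hfg.symm
  set g := hkIntegral A C σ η Υ ν₁ ν₂ (-γ₁) (-γ₂) ((-γ₁ + 1) / 2) (-γ₂) f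
  -- Passing to a strongly measurable representative `φ` of `ψ`.
  set φ := hψ.1.mk ψ
  have hψφ : ψ =ᵐ[volume.restrict (openBox A B C D)] φ := hψ.1.ae_eq_mk
  have hφ : IntegrableOn φ (openBox A B C D) := hψ.congr hψφ
  have hg : g =ᵐ[volume.restrict (openBox A B C D)]
      boxConv (openBox A B C D) (openBox 0 (B - A) 0 (D - C)) φ (powKer₂ (κ + σ) (ρ + η)) := by
    refine (hkIntegral_ae_eq_boxConv hAB hCD hσ hη hΥ ν₁ ν₂ (-γ₁) (-γ₂) hfint).trans ?_
    rw [boxConv_congr_ae hmR hfg, ← boxConv_congr_ae hmR hψφ]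
    exact ae_boxConv_boxConv hψ hk hk' fun z hz =>
      integral_hkKernel_mul_hkKernel_neg hκ hρ hσ hη hΥ ν₁ ν₂ γ₁ γ₂ hz.1.1 hz.2.1
  have hα : 0 < (κ + σ).re := by rw [Complex.add_re]; positivity
  have hβ : 0 < (ρ + η).re := by rw [Complex.add_re]; positivity
  have hG : ∀ x ∈ Ioo A B, ∀ y ∈ Ioo C D, _ := fun x hx y hy =>
    rlIntegral₂_eq_cauchyInt hAB hCD hα hβ hφ hg (p := (x, y)) ⟨hx, hy⟩
  have hder := ae_iterDifferentiableAt_cauchyInt₂ ⌊(κ + σ).re⌋₊ ⌊(ρ + η).re⌋₊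
    (hψ.1.stronglyMeasurable_mk.indicator hmR) (hφ.integrable_indicator hmR) (A := A) (C := C)
    (fun t ht w => indicator_of_notMem (fun h => not_lt.2 ht h.1.1) _)
    (fun t w hw => indicator_of_notMem (fun h => not_lt.2 hw h.2.1) _)
  rw [ae_restrict_iff' hmR]
  filter_upwards [hder, (ae_restrict_iff' hmR).1 hψφ] with p ⟨hp1, hp2, hp3⟩ hpψ hpR
  have hx : ∀ y ∈ Ioo C D, _ =ᶠ[𝓝 p.1] _ := fun y hy => by
    filter_upwards [Ioo_mem_nhds hpR.1.1 hpR.1.2] with x hx using hG x hx y hy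
  have hyn := Ioo_mem_nhds hpR.2.1 hpR.2.2
  have hy : (fun y : ℝ => iteratedDeriv (rlOrder (κ + σ)) (fun x : ℝ =>
      rlIntegral₂ A C (rlOrder (κ + σ) - (κ + σ)) (rlOrder (ρ + η) - (ρ + η)) g (x, y)) p.1)
      =ᶠ[𝓝 p.2] cauchyInt ⌊(ρ + η).re⌋₊ fun w => (openBox A B C D).indicator φ (p.1, w) := by
    filter_upwards [hyn] with y hy
    exact ((hx y hy).iteratedDeriv_eq _).trans (hp1 y).2
  refine ⟨⟨?_, hp2.congr_of_eventuallyEq hy⟩, ?_⟩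
  · filter_upwards [hyn] with y hy
    exact (hp1 y).1.congr_of_eventuallyEq (hx y hy)
  · rw [hkDeriv, rlDeriv₂]
    refine ((hy.iteratedDeriv_eq _).trans hp3).trans ?_
    rw [indicator_of_mem hpR, hpψ hpR]
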